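/- **Conventions.** A Lie conformal algebra is a $\mathbb{C}[\partial]$-module $L$ with a $\mathbb{C}$-bilinear $\lambda$-bracket $[a_\lambda b]\in\mathbb{C}[\lambda]\otimes L$ satisfying $[\partial a_\lambda b]=-\lambda[a_\lambda b]$, $[a_\lambda\partial b]=(\lambda+\partial)[a_\lambda b]$, $[a_\lambda b]=-[b_{-\lambda-\partial}a]$ and $[a_\lambda[b_\mu c]]=[[a_\lambda b]_{\lambda+\mu}c]+[b_\mu[a_\lambda c]]$. A $\mathbb{C}[\partial]$-submodule $J$ is an ideal if $[a_\lambda b],[b_\lambda a]\in\mathbb{C}[\lambda]\otimes J$ for all $a\in L$, $b\in J$; it has cofinite rank if $L/J$ has finite rank over $\mathbb{C}[\partial]$; it is nontrivial if $0\ne J\neq L$. The conformal dual $L^{*c}$ is the space of $\mathbb{C}$-linear maps $f:L\to\mathbb{C}[\lambda]$ with $f_\lambda(\partial b)=\lambda f_\lambda(b)$, with $(\partial f)_\lambda=-\lambda f_\lambda$. A $\mathbb{C}[\partial]$-submodule $V\subseteq L^{*c}$ is good if for each $f\in V$ there is $\delta_V(f)=\sum f_{(1)}\otimes f_{(2)}\in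 V\otimes V$ with $f_\lambda([a_\mu b])=\sum (f_{(1)})_{-\mu}(a)\,(f_{(2)})_{\lambda+\mu}(b)$ for all $a,b\in L$. $L^0$ is the sum of all good submodules; it is itself good and, with $\delta_{L^0}$, is a differential Lie coalgebra (a Lie coalgebra with a $\mathbb{C}[\partial]$-action such that $\delta(\partial x)=(\partial\otimes1+1\otimes\partial)\delta(x)$). For a differential Lie coalgebra $M$, $\operatorname{Loc}(M)$ is the sum of all its differential Lie subcoalgebras of finite rank. For a Lie algebra $\mathfrak g$ over $\mathbb{C}$, $\operatorname{Cur}(\mathfrak g)=\mathbb{C}[\partial]\otimes\mathfrak g$ is the Lie conformal algebra with $[f\otimes a\,_\lambda\,h\otimes b]=f(-\lambda)h(\lambda+\partial)\otimes[a,b]$. For a vector space $V$, put $\operatorname{Cur}(V)=\mathbb{C}[\partial]\otimes V$ and let $\Theta:\operatorname{Cur}(V^*)\hookrightarrow(\operatorname{Cur}(V))^{*c}$ be given by $\Theta(p\otimes\phi)_\lambda(q\otimes v)=p(-\lambda)q(\lambda)\phi(v)$. A subspace $V\subseteq\mathfrak g^*$ is good if there is $\delta:V\to V\otimes V$ (necessarily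 unique, the coproduct of $V$) with $f([x,y])=\sum f_{(1)}(x)f_{(2)}(y)$ for all $f\in V$ and $x,y\in\mathfrak g$. **Proposition.** Let $\mathfrak g=\bigoplus_{i\ge0}\mathbb{C}e_i$ be the Lie algebra over $\mathbb{C}$ with $[e_0,e_k]=e_{k-1}=-[e_k,e_0]$ for $k\ge2$ and all other brackets of basis vectors equal to $0$, and let $e_i^*\in\mathfrak g^*$ be the coordinate functionals, $e_i^*(e_j)=\delta_{ij}$. (a) For every $a\in\mathbb{C}[\partial]$, $$J_a:=\big(a(\partial)\mathbb{C}[\partial]\otimes e_0\big)\oplus\Big(\bigoplus_{i\ge1}\mathbb{C}[\partial]\otimes e_i\Big)$$ is an ideal of $\operatorname{Cur}(\mathfrak g)$, and the nontrivial ideals of cofinite rank of $\operatorname{Cur}(\mathfrak g)$ are exactly the $J_a$ with $a\in\mathbb{C}[\partial]$ not a nonzero constant (the case $a=0$ is included). (b) $0\ne\mathbb{C}[\partial]e_0^*=\operatorname{Loc}\big((\operatorname{Cur}(\mathfrak g))^0\big)$, where $e_0^*$ is identified with $\Theta(1\otimes e_0^*)$. (c) $\bigoplus_{i\ge0}\mathbb{C}e_i^*$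 is a good subspace of $\mathfrak g^*$, with coproduct $\delta(e_0^*)=0$ and $\delta(e_i^*)=e_0^*\otimes e_{i+1}^*-e_{i+1}^*\otimes e_0^*$ for all $i\ge1$. (d) $\Theta\big(\operatorname{Cur}(\bigoplus_{i\ge0}\mathbb{C}e_i^*)\big)\subseteq(\operatorname{Cur}(\mathfrak g))^0$. (e) $0\ne\operatorname{Loc}\big((\operatorname{Cur}(\mathfrak g))^0\big)\subsetneq(\operatorname{Cur}(\mathfrak g))^0$. -/

import Mathlib

open Polynomial TensorProduct

namespace ConformalAlg

noncomputable section

set_option linter.unusedSectionVars false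

/-! # Conventions

The polynomial ring `ℂ[∂]` is `ℂ[X]`, with `∂ = X`.  A `ℂ[∂]`-module is a complex vector space
with a compatible `ℂ[X]`-module structure.  Polynomials in the formal variables `λ`, `μ` with
coefficients in a complex vector space are determined by their values at all complex numbers
(see `ext_of_subst` below); identities between them are stated for all complex values of the
variables. -/

/-! ## Tensors are determined by separating families of functionals -/

section Separation

variable {V W A B : Type*} [AddCommGroup V] [Module ℂ V] [AddCommGroup W] [Module ℂ W]

/-- The functional `v ⊗ w ↦ φ v * ψ w`. -/
def tensorFunctional (φ : V →ₗ[ℂ] ℂ) (ψ : W →ₗ[ℂ] ℂ) : V ⊗[ℂ] W →ₗ[ℂ] ℂ :=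
  LinearMap.mul' ℂ ℂ ∘ₗ TensorProduct.map φ ψ

@[simp] lemma tensorFunctional_tmul (φ : V →ₗ[ℂ] ℂ) (ψ : W →ₗ[ℂ] ℂ) (v : V) (w : W) :
    tensorFunctional φ ψ (v ⊗ₜ w) = φ v * ψ w := by
  simp [tensorFunctional]

lemma tensorFunctional_eq_right (φ : V →ₗ[ℂ] ℂ) (ψ : W →ₗ[ℂ] ℂ) (t : V ⊗[ℂ] W) :
    tensorFunctional φ ψ t = φ (TensorProduct.rid ℂ V (LinearMap.lTensor V ψ t)) := by
  induction t using TensorProduct.induction_on with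
  | zero => simp
  | tmul v w => simp [mul_comm]
  | add x y hx hy => simp only [map_add, hx, hy]

lemma tensorFunctional_eq_left (φ : V →ₗ[ℂ] ℂ) (ψ : W →ₗ[ℂ] ℂ) (t : V ⊗[ℂ] W) :
    tensorFunctional φ ψ t = ψ (TensorProduct.lid ℂ W (LinearMap.rTensor W φ t)) := by
  induction t using TensorProduct.induction_on with
  | zero => simp
  | tmul v w => simp
  | add x y hx hy => simp only [map_add, hx, hy]

lemma tensor_eq_zero_of_separating (φ : A → V →ₗ[ℂ] ℂ) (ψ : B → W →ₗ[ℂ] ℂ)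
    (hφ : ∀ v, (∀ a, φ a v = 0) → v = 0) (hψ : ∀ w, (∀ b, ψ b w = 0) → w = 0)
    (t : V ⊗[ℂ] W) (h : ∀ a b, tensorFunctional (φ a) (ψ b) t = 0) : t = 0 := by
  classical
  have key : ∀ b, TensorProduct.rid ℂ V (LinearMap.lTensor V (ψ b) t) = 0 := fun b =>
    hφ _ fun a => by rw [← tensorFunctional_eq_right, h]
  apply (TensorProduct.equivFinsuppOfBasisLeft (N := W) (Module.Basis.ofVectorSpace ℂ V)).injective
  rw [map_zero]
  ext i
  rw [TensorProduct.equivFinsuppOfBasisLeft_apply, Finsupp.zero_apply]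
  refine hψ _ fun b => ?_
  rw [← tensorFunctional_eq_left, tensorFunctional_eq_right, key, map_zero]

end Separation

/-! ## Lie conformal algebras -/

section LieConformal

variable {L : Type*} [AddCommGroup L] [Module ℂ L] [Module ℂ[X] L] [IsScalarTower ℂ ℂ[X] L]

/-- Substitution `λ = s(∂)` in an element of `ℂ[λ] ⊗ L`: `p(λ) ⊗ v ↦ p(s(∂)) v`.
For a constant polynomial `s = C z` this is evaluation at `λ = z`. -/
def subst (s : ℂ[X]) : ℂ[X] ⊗[ℂ] L →ₗ[ℂ] L :=
  TensorProduct.lift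
    ((Algebra.lsmul ℂ ℂ L).toLinearMap ∘ₗ (Polynomial.aeval (R := ℂ) s).toLinearMap)

@[simp] lemma subst_tmul (s p : ℂ[X]) (v : L) :
    subst s (p ⊗ₜ[ℂ] v) = (p.comp s) • v := by
  simp [subst, Polynomial.comp, Polynomial.aeval_def]

/-- An element of `ℂ[λ] ⊗ L` is determined by its values at all complex numbers. -/
lemma ext_of_subst (u v : ℂ[X] ⊗[ℂ] L) (h : ∀ z : ℂ, subst (C z) u = subst (C z) v) :
    u = v := by
  rw [← sub_eq_zero]
  refine tensor_eq_zero_of_separating (fun z : ℂ => (Polynomial.leval z : ℂ[X] →ₗ[ℂ] ℂ))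
    (fun φ : Module.Dual ℂ L => φ) (fun p hp => Polynomial.funext fun z => by simpa using hp z)
    (fun w hw => (Module.forall_dual_apply_eq_zero_iff ℂ w).1 hw) _ fun z φ => ?_
  have key : ∀ t : ℂ[X] ⊗[ℂ] L,
      tensorFunctional (Polynomial.leval z : ℂ[X] →ₗ[ℂ] ℂ) φ t = φ (subst (C z) t) := by
    intro t
    induction t using TensorProduct.induction_on with
    | zero => simp
    | tmul p w =>
      rw [tensorFunctional_tmul, subst_tmul, Polynomial.comp_C, ← Polynomial.algebraMap_eq,
        algebraMap_smul]
      simp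
    | add x y hx hy => simp only [map_add, hx, hy]
  rw [key, map_sub, h, sub_self, map_zero]

/-- A Lie conformal algebra structure on a `ℂ[∂]`-module `L`: a `λ`-bracket
`[a_λ b] ∈ ℂ[λ] ⊗ L`, `ℂ`-bilinear in `a`, `b`, with conformal sesquilinearity, skew-symmetry
and the Jacobi identity. -/
class LieConformalAlgebra (L : Type*) [AddCommGroup L] [Module ℂ L] [Module ℂ[X] L]
    [IsScalarTower ℂ ℂ[X] L] where
  /-- `bracket a b` is `[a_λ b]`. -/
  bracket : L →ₗ[ℂ] L →ₗ[ℂ] ℂ[X] ⊗[ℂ] L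
  /-- `[∂a_λ b] = -λ [a_λ b]`. -/
  sesq_left : ∀ (a b : L) (l : ℂ),
    subst (C l) (bracket ((X : ℂ[X]) • a) b) = -(l • subst (C l) (bracket a b))
  /-- `[a_λ ∂b] = (λ + ∂) [a_λ b]`. -/
  sesq_right : ∀ (a b : L) (l : ℂ),
    subst (C l) (bracket a ((X : ℂ[X]) • b)) = (C l + X : ℂ[X]) • subst (C l) (bracket a b)
  /-- `[a_λ b] = -[b_{-λ-∂} a]`. -/
  skew : ∀ (a b : L) (l : ℂ),
    subst (C l) (bracket a b) = -subst (-C l - X) (bracket b a)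
  /-- `[a_λ [b_μ c]] = [[a_λ b]_{λ+μ} c] + [b_μ [a_λ c]]`. -/
  jacobi : ∀ (a b c : L) (l m : ℂ),
    subst (C l) (bracket a (subst (C m) (bracket b c))) =
      subst (C (l + m)) (bracket (subst (C l) (bracket a b)) c) +
        subst (C m) (bracket b (subst (C l) (bracket a c)))

/-- A `ℂ[∂]`-submodule `J` of `L` is an ideal if `[a_λ b]` and `[b_λ a]` lie in `ℂ[λ] ⊗ J`
for all `a ∈ L`, `b ∈ J`. -/
def IsIdeal [LieConformalAlgebra L] (J : Submodule ℂ[X] L) : Prop :=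
  ∀ a : L, ∀ b ∈ J,
    LieConformalAlgebra.bracket a b ∈
        LinearMap.range (LinearMap.lTensor ℂ[X] (J.subtype.restrictScalars ℂ)) ∧
      LieConformalAlgebra.bracket b a ∈
        LinearMap.range (LinearMap.lTensor ℂ[X] (J.subtype.restrictScalars ℂ))

/-- `L / J` has finite rank as a `ℂ[∂]`-module. -/
def CofiniteRank (J : Submodule ℂ[X] L) : Prop :=
  Module.rank ℂ[X] (L ⧸ J) < Cardinal.aleph0

end LieConformal

/-! ## The conformal dual -/

section Dual

variable (L : Type*) [AddCommGroup L] [Module ℂ L] [Module ℂ[X] L] [IsScalarTower ℂ ℂ[X] L]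

/-- The space of `ℂ`-linear maps `f : L → ℂ[λ]` with `f_λ(∂b) = λ f_λ(b)`. -/
def conformalDualSubmodule : Submodule ℂ (L →ₗ[ℂ] ℂ[X]) where
  carrier := {f | ∀ b : L, f ((X : ℂ[X]) • b) = X * f b}
  zero_mem' := by intro b; simp
  add_mem' := by
    intro f g hf hg b
    simp only [LinearMap.add_apply, hf b, hg b, mul_add]
  smul_mem' := by
    intro c f hf b
    simp only [LinearMap.smul_apply, hf b, mul_smul_comm]

/-- The conformal dual of `L`. -/
def ConformalDual : Type _ := ↥(conformalDualSubmodule L)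

instance : AddCommGroup (ConformalDual L) :=
  inferInstanceAs (AddCommGroup ↥(conformalDualSubmodule L))

instance : Module ℂ (ConformalDual L) :=
  inferInstanceAs (Module ℂ ↥(conformalDualSubmodule L))

variable {L}

/-- The underlying linear map `L → ℂ[λ]`. -/
def ConformalDual.toLin : ConformalDual L →ₗ[ℂ] (L →ₗ[ℂ] ℂ[X]) :=
  (conformalDualSubmodule L).subtype

lemma ConformalDual.toLin_injective :
    Function.Injective (ConformalDual.toLin : ConformalDual L → (L →ₗ[ℂ] ℂ[X])) :=
  Subtype.val_injective

lemma ConformalDual.toLin_X_smul (f : ConformalDual L) (b : L) :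
    f.toLin ((X : ℂ[X]) • b) = X * f.toLin b := f.2 b

/-- The `ℂ[∂]`-action on the conformal dual: `(p(∂) f)_λ = p(-λ) f_λ`,
in particular `(∂f)_λ = -λ f_λ`. -/
instance : SMul ℂ[X] (ConformalDual L) where
  smul p f := ⟨LinearMap.mulLeft ℂ (p.comp (-X)) ∘ₗ f.toLin, fun b => by
    simp only [LinearMap.comp_apply, LinearMap.mulLeft_apply, f.toLin_X_smul]
    ring⟩

lemma ConformalDual.toLin_smul (p : ℂ[X]) (f : ConformalDual L) (b : L) :
    (p • f).toLin b = p.comp (-X) * f.toLin b := rfl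

instance : Module ℂ[X] (ConformalDual L) where
  one_smul f := by
    apply ConformalDual.toLin_injective; ext1 b
    simp [ConformalDual.toLin_smul]
  mul_smul p q f := by
    apply ConformalDual.toLin_injective; ext1 b
    simp [ConformalDual.toLin_smul, mul_assoc]
  smul_zero p := by
    apply ConformalDual.toLin_injective; ext1 b
    simp [ConformalDual.toLin_smul]
  smul_add p f g := by
    apply ConformalDual.toLin_injective; ext1 b
    simp [ConformalDual.toLin_smul, mul_add]
  add_smul p q f := by
    apply ConformalDual.toLin_injective; ext1 b
    simp [ConformalDual.toLin_smul, add_mul]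
  zero_smul f := by
    apply ConformalDual.toLin_injective; ext1 b
    simp [ConformalDual.toLin_smul]

instance : IsScalarTower ℂ ℂ[X] (ConformalDual L) where
  smul_assoc c p f := by
    apply ConformalDual.toLin_injective; ext1 b
    simp [ConformalDual.toLin_smul, Polynomial.smul_comp]

/-- `ev l a` is the functional `f ↦ f_l(a)`, for `l ∈ ℂ` and `a ∈ L`. -/
def ev (l : ℂ) (a : L) : ConformalDual L →ₗ[ℂ] ℂ :=
  Polynomial.leval l ∘ₗ LinearMap.applyₗ a ∘ₗ ConformalDual.toLin

lemma ev_apply (l : ℂ) (a : L) (f : ConformalDual L) : ev l a f = (f.toLin a).eval l := rfl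

lemma ev_smul (l : ℂ) (a : L) (p : ℂ[X]) (f : ConformalDual L) :
    ev l a (p • f) = p.eval (-l) * ev l a f := by
  simp [ev_apply, ConformalDual.toLin_smul]

lemma ev_add_left (l : ℂ) (a b : L) (f : ConformalDual L) :
    ev l (a + b) f = ev l a f + ev l b f := by
  simp [ev_apply]

lemma toLin_apply_smul (p : ℂ[X]) (a : L) (f : ConformalDual L) :
    f.toLin (p • a) = p * f.toLin a := by
  induction p using Polynomial.induction_on' with
  | add p q hp hq => rw [add_smul, map_add, hp, hq, add_mul]
  | monomial n c =>
    rw [← Polynomial.C_mul_X_pow_eq_monomial, mul_smul, ← Polynomial.algebraMap_eq,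
      algebraMap_smul, map_smul, mul_assoc, ← Algebra.smul_def]
    congr 1
    induction n with
    | zero => simp
    | succ n ih => rw [pow_succ', mul_smul, f.toLin_X_smul, ih, mul_assoc]

lemma ev_smul_left (l : ℂ) (p : ℂ[X]) (a : L) (f : ConformalDual L) :
    ev l (p • a) f = p.eval l * ev l a f := by
  simp [ev_apply, toLin_apply_smul]

lemma ev_separating (f : ConformalDual L) (h : ∀ la : ℂ × L, ev la.1 la.2 f = 0) : f = 0 := by
  apply ConformalDual.toLin_injective
  ext1 a
  exact Polynomial.funext fun l => by simpa [ev_apply] using h (l, a)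

lemma ev_subst (l : ℂ) (s : ℂ[X]) (u : ℂ[X] ⊗[ℂ] L) (f : ConformalDual L) :
    ev l (subst s u) f = ev l (subst (C (s.eval l)) u) f := by
  induction u using TensorProduct.induction_on with
  | zero => simp
  | tmul p v => simp [ev_smul_left, Polynomial.eval_comp]
  | add x y hx hy => simp only [map_add, ev_add_left, hx, hy]

end Dual

/-! ## Differential Lie coalgebras and their locally finite part -/

section Coalgebra

/-- A differential Lie coalgebra structure on a `ℂ[∂]`-module `M`.  The tensor square carries
the action `∂(u ⊗ v) = ∂u ⊗ v + u ⊗ ∂v`. -/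
class DifferentialLieCoalgebra (M : Type*) [AddCommGroup M] [Module ℂ M] [Module ℂ[X] M]
    [IsScalarTower ℂ ℂ[X] M] where
  /-- The coproduct. -/
  comul : M →ₗ[ℂ] M ⊗[ℂ] M
  /-- The coproduct commutes with `∂`. -/
  comul_X_smul : ∀ x : M, comul ((X : ℂ[X]) • x) =
    LinearMap.rTensor M (Algebra.lsmul ℂ ℂ M (X : ℂ[X])) (comul x) +
      LinearMap.lTensor M (Algebra.lsmul ℂ ℂ M (X : ℂ[X])) (comul x)
  /-- `τ ∘ δ = -δ`. -/
  coskew : ∀ x : M, TensorProduct.comm ℂ M M (comul x) = -comul x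
  /-- `(I ⊗ δ)δ - (τ ⊗ I)(I ⊗ δ)δ = (δ ⊗ I)δ`. -/
  cojacobi : ∀ x : M,
    LinearMap.lTensor M comul (comul x) -
        TensorProduct.leftComm ℂ M M M (LinearMap.lTensor M comul (comul x)) =
      TensorProduct.assoc ℂ M M M (LinearMap.rTensor M comul (comul x))

variable {M : Type*} [AddCommGroup M] [Module ℂ M] [Module ℂ[X] M] [IsScalarTower ℂ ℂ[X] M]

/-- A `ℂ[∂]`-submodule `N` with `δ(N) ⊆ N ⊗ N`. -/
def IsSubcoalgebra [DifferentialLieCoalgebra M] (N : Submodule ℂ[X] M) : Prop :=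
  ∀ x ∈ N, DifferentialLieCoalgebra.comul x ∈
    LinearMap.range
      (TensorProduct.map (N.subtype.restrictScalars ℂ) (N.subtype.restrictScalars ℂ))

variable (M) in
/-- `Loc(M)` is the sum of all differential Lie subcoalgebras of finite rank of `M`. -/
def Loc [DifferentialLieCoalgebra M] : Submodule ℂ[X] M :=
  sSup {N | IsSubcoalgebra N ∧ Module.rank ℂ[X] N < Cardinal.aleph0}

end Coalgebra

/-! ## Good submodules and the upper zero -/

section UpperZero

variable {L : Type*} [AddCommGroup L] [Module ℂ L] [Module ℂ[X] L] [IsScalarTower ℂ ℂ[X] L]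

/-- `[Φ_m(f ⊗ g)]_l (a ⊗ b) = f_m(a) g_{l-m}(b)`. -/
def phiMap (m : ℂ) : ConformalDual L ⊗[ℂ] ConformalDual L →ₗ[ℂ] (ℂ → L → L → ℂ) :=
  LinearMap.pi fun l => LinearMap.pi fun a => LinearMap.pi fun b =>
    tensorFunctional (ev m a) (ev (l - m) b)

lemma phiMap_tmul (m l : ℂ) (f g : ConformalDual L) (a b : L) :
    phiMap m (f ⊗ₜ g) l a b = (f.toLin a).eval m * (g.toLin b).eval (l - m) := by
  simp [phiMap, ev_apply]

/-- The inclusion `V ⊗ V → L^{*c} ⊗ L^{*c}`. -/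
def inclTensor (V : Submodule ℂ[X] (ConformalDual L)) :
    ↥V ⊗[ℂ] ↥V →ₗ[ℂ] ConformalDual L ⊗[ℂ] ConformalDual L :=
  TensorProduct.map (V.subtype.restrictScalars ℂ) (V.subtype.restrictScalars ℂ)

variable [LieConformalAlgebra L]

/-- `[π_m(f)]_l (a ⊗ b) = f_l([a_m b])`. -/
def piMap (m : ℂ) : ConformalDual L →ₗ[ℂ] (ℂ → L → L → ℂ) :=
  LinearMap.pi fun l => LinearMap.pi fun a => LinearMap.pi fun b =>
    ev l (subst (C m) (LieConformalAlgebra.bracket a b))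

/-- `V` is good if `π_μ(V) ⊆ Φ_{-μ}(V ⊗ V)`, as polynomials in `μ`: for each `f ∈ V` there is
`t ∈ V ⊗ V`, independent of `μ`, with `π_μ(f) = Φ_{-μ}(t)`. -/
def IsGood (V : Submodule ℂ[X] (ConformalDual L)) : Prop :=
  ∀ f ∈ V, ∃ t : ↥V ⊗[ℂ] ↥V, ∀ m : ℂ, piMap m f = phiMap (-m) (inclTensor V t)

variable (L) in
/-- `L⁰`, the sum of all good submodules of the conformal dual. -/
def upperZero : Submodule ℂ[X] (ConformalDual L) := sSup {V | IsGood V}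

lemma inclTensor_mono {V W : Submodule ℂ[X] (ConformalDual L)} (h : V ≤ W)
    (t : ↥V ⊗[ℂ] ↥V) : ∃ u : ↥W ⊗[ℂ] ↥W, inclTensor W u = inclTensor V t := by
  refine ⟨TensorProduct.map ((Submodule.inclusion h).restrictScalars ℂ)
    ((Submodule.inclusion h).restrictScalars ℂ) t, ?_⟩
  induction t using TensorProduct.induction_on with
  | zero => simp
  | tmul x y => simp [inclTensor]
  | add x y hx hy => simp only [map_add, hx, hy]

lemma upperZero_isGood : IsGood (upperZero L) := by
  intro f hf
  rw [upperZero, sSup_eq_iSup'] at hf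
  induction hf using Submodule.iSup_induction' with
  | mem V x hx =>
    obtain ⟨t, ht⟩ := V.2 x hx
    have hle : V.1 ≤ upperZero L := le_sSup V.2
    obtain ⟨u, hu⟩ := inclTensor_mono hle t
    exact ⟨u, fun m => by rw [ht m, hu]⟩
  | zero => exact ⟨0, fun m => by simp⟩
  | add x y hx hy ihx ihy =>
    obtain ⟨t, ht⟩ := ihx
    obtain ⟨u, hu⟩ := ihy
    exact ⟨t + u, fun m => by simp only [map_add, ht m, hu m]⟩

section Coproduct

variable {V : Submodule ℂ[X] (ConformalDual L)}

/-- The restriction to `V` of the functional `f ↦ f_l(a)`. -/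
def evOn (V : Submodule ℂ[X] (ConformalDual L)) (l : ℂ) (a : L) : ↥V →ₗ[ℂ] ℂ :=
  ev l a ∘ₗ V.subtype.restrictScalars ℂ

lemma evOn_apply (l : ℂ) (a : L) (f : ↥V) : evOn V l a f = ev l a f.1 := rfl

lemma evOn_separating (f : ↥V) (h : ∀ la : ℂ × L, evOn V la.1 la.2 f = 0) : f = 0 :=
  Subtype.ext (ev_separating f.1 h)

lemma phiMap_inclTensor (m l : ℂ) (t : ↥V ⊗[ℂ] ↥V) (a b : L) :
    phiMap m (inclTensor V t) l a b = tensorFunctional (evOn V m a) (evOn V (l - m) b) t := by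
  induction t using TensorProduct.induction_on with
  | zero => simp
  | tmul x y => simp [inclTensor, phiMap, evOn_apply]
  | add x y hx hy => simp only [map_add, Pi.add_apply, hx, hy]

lemma tensor_ext_evOn (t u : ↥V ⊗[ℂ] ↥V)
    (h : ∀ (x y : ℂ) (a b : L), tensorFunctional (evOn V x a) (evOn V y b) t =
      tensorFunctional (evOn V x a) (evOn V y b) u) : t = u := by
  rw [← sub_eq_zero]
  refine tensor_eq_zero_of_separating (fun la : ℂ × L => evOn V la.1 la.2)
    (fun la : ℂ × L => evOn V la.1 la.2) evOn_separating evOn_separating _ fun a b => ?_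
  rw [map_sub, h, sub_self]

lemma phiMap_inclTensor_injective (t u : ↥V ⊗[ℂ] ↥V)
    (h : ∀ m : ℂ, phiMap (-m) (inclTensor V t) = phiMap (-m) (inclTensor V u)) : t = u := by
  refine tensor_ext_evOn t u fun x y a b => ?_
  have := congrFun (congrFun (congrFun (h (-x)) (x + y)) a) b
  rw [phiMap_inclTensor, phiMap_inclTensor] at this
  simpa using this

lemma exists_coproduct (hV : IsGood V) :
    ∃ δ : ↥V →ₗ[ℂ] ↥V ⊗[ℂ] ↥V,
      ∀ (f : ↥V) (m : ℂ), phiMap (-m) (inclTensor V (δ f)) = piMap m f.1 := by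
  choose t ht using fun f : ↥V => hV f.1 f.2
  refine ⟨{ toFun := t, map_add' := fun f g => ?_, map_smul' := fun c f => ?_ },
    fun f m => (ht f m).symm⟩
  · refine phiMap_inclTensor_injective _ _ fun m => ?_
    rw [← ht, map_add, map_add, ← ht, ← ht, Submodule.coe_add, map_add]
  · refine phiMap_inclTensor_injective _ _ fun m => ?_
    have hc : ((c • f : ↥V) : ConformalDual L) = c • (f : ConformalDual L) := rfl
    rw [← ht, RingHom.id_apply, map_smul, map_smul, ← ht, hc, map_smul]

/-- The coproduct `δ_V` of a good submodule `V`, characterized by `Φ_{-μ} ∘ δ_V = π_μ`. -/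
def coproduct (hV : IsGood V) : ↥V →ₗ[ℂ] ↥V ⊗[ℂ] ↥V :=
  Classical.choose (exists_coproduct hV)

lemma phiMap_coproduct (hV : IsGood V) (f : ↥V) (m : ℂ) :
    phiMap (-m) (inclTensor V (coproduct hV f)) = piMap m f.1 :=
  Classical.choose_spec (exists_coproduct hV) f m

lemma tensorFunctional_coproduct (hV : IsGood V) (f : ↥V) (x y : ℂ) (a b : L) :
    tensorFunctional (evOn V x a) (evOn V y b) (coproduct hV f) =
      evOn V (x + y) (subst (C (-x)) (LieConformalAlgebra.bracket a b)) f := by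
  have := congrFun (congrFun (congrFun (phiMap_coproduct hV f (-x)) (x + y)) a) b
  rw [phiMap_inclTensor, neg_neg, add_sub_cancel_left] at this
  exact this

lemma tensorFunctional_comp_coproduct (hV : IsGood V) (x y : ℂ) (a b : L) :
    tensorFunctional (evOn V x a) (evOn V y b) ∘ₗ coproduct hV =
      evOn V (x + y) (subst (C (-x)) (LieConformalAlgebra.bracket a b)) :=
  LinearMap.ext fun f => tensorFunctional_coproduct hV f x y a b

section TensorIdentities

variable {U₁ U₂ U₃ : Type*} [AddCommGroup U₁] [Module ℂ U₁] [AddCommGroup U₂] [Module ℂ U₂]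
  [AddCommGroup U₃] [Module ℂ U₃]

lemma tensorFunctional_comm (φ : U₁ →ₗ[ℂ] ℂ) (ψ : U₂ →ₗ[ℂ] ℂ) (t : U₁ ⊗[ℂ] U₂) :
    tensorFunctional ψ φ (TensorProduct.comm ℂ U₁ U₂ t) = tensorFunctional φ ψ t := by
  induction t using TensorProduct.induction_on with
  | zero => simp
  | tmul x y => simp [mul_comm]
  | add x y hx hy => simp only [map_add, hx, hy]

lemma tensorFunctional_lTensor (φ : U₁ →ₗ[ℂ] ℂ) (ψ : U₂ →ₗ[ℂ] ℂ) (F : U₃ →ₗ[ℂ] U₂)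
    (t : U₁ ⊗[ℂ] U₃) :
    tensorFunctional φ ψ (LinearMap.lTensor U₁ F t) = tensorFunctional φ (ψ ∘ₗ F) t := by
  induction t using TensorProduct.induction_on with
  | zero => simp
  | tmul x y => simp
  | add x y hx hy => simp only [map_add, hx, hy]

lemma tensorFunctional_rTensor (φ : U₁ →ₗ[ℂ] ℂ) (ψ : U₂ →ₗ[ℂ] ℂ) (F : U₃ →ₗ[ℂ] U₁)
    (t : U₃ ⊗[ℂ] U₂) :
    tensorFunctional φ ψ (LinearMap.rTensor U₂ F t) = tensorFunctional (φ ∘ₗ F) ψ t := by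
  induction t using TensorProduct.induction_on with
  | zero => simp
  | tmul x y => simp
  | add x y hx hy => simp only [map_add, hx, hy]

lemma tensorFunctional_leftComm (φ : U₁ →ₗ[ℂ] ℂ) (ψ : U₂ →ₗ[ℂ] ℂ) (χ : U₃ →ₗ[ℂ] ℂ)
    (t : U₂ ⊗[ℂ] (U₁ ⊗[ℂ] U₃)) :
    tensorFunctional φ (tensorFunctional ψ χ) (TensorProduct.leftComm ℂ U₂ U₁ U₃ t) =
      tensorFunctional ψ (tensorFunctional φ χ) t := by
  induction t using TensorProduct.induction_on with
  | zero => simp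
  | tmul x y =>
    induction y using TensorProduct.induction_on with
    | zero => simp
    | tmul y z => simp; ring
    | add y z hy hz => simp only [map_add, TensorProduct.tmul_add, hy, hz]
  | add x y hx hy => simp only [map_add, hx, hy]

lemma tensorFunctional_assoc (φ : U₁ →ₗ[ℂ] ℂ) (ψ : U₂ →ₗ[ℂ] ℂ) (χ : U₃ →ₗ[ℂ] ℂ)
    (t : (U₁ ⊗[ℂ] U₂) ⊗[ℂ] U₃) :
    tensorFunctional φ (tensorFunctional ψ χ) (TensorProduct.assoc ℂ U₁ U₂ U₃ t) =
      tensorFunctional (tensorFunctional φ ψ) χ t := by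
  induction t using TensorProduct.induction_on with
  | zero => simp
  | tmul y x =>
    induction y using TensorProduct.induction_on with
    | zero => simp
    | tmul y z => simp; ring
    | add y z hy hz => simp only [map_add, TensorProduct.add_tmul, hy, hz]
  | add x y hx hy => simp only [map_add, hx, hy]

end TensorIdentities

lemma tensor_ext_evOn₃ (t u : ↥V ⊗[ℂ] (↥V ⊗[ℂ] ↥V))
    (h : ∀ (x y z : ℂ) (a b c : L),
      tensorFunctional (evOn V x a) (tensorFunctional (evOn V y b) (evOn V z c)) t =
      tensorFunctional (evOn V x a) (tensorFunctional (evOn V y b) (evOn V z c)) u) : t = u := by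
  rw [← sub_eq_zero]
  refine tensor_eq_zero_of_separating (fun la : ℂ × L => evOn V la.1 la.2)
    (fun la : (ℂ × L) × (ℂ × L) =>
      tensorFunctional (evOn V la.1.1 la.1.2) (evOn V la.2.1 la.2.2)) evOn_separating
    (fun w hw => tensor_ext_evOn w 0 fun x y a b => by
      rw [map_zero]; exact hw ((x, a), (y, b))) _ fun a b => ?_
  rw [map_sub, h, sub_self]

/-- A good submodule `V` with its coproduct `δ_V` is a differential Lie coalgebra. -/
@[reducible] def goodCoalgebra (hV : IsGood V) : DifferentialLieCoalgebra ↥V where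
  comul := coproduct hV
  comul_X_smul f := by
    refine tensor_ext_evOn _ _ fun x y a b => ?_
    have h : ∀ (l : ℂ) (c : L),
        evOn V l c ∘ₗ (Algebra.lsmul ℂ ℂ ↥V (X : ℂ[X])) = (-l) • evOn V l c := by
      intro l c
      ext g
      change ev l c ((X : ℂ[X]) • g.1) = -l * ev l c g.1
      rw [ev_smul, Polynomial.eval_X]
    have h1 : ∀ t : ↥V ⊗[ℂ] ↥V, tensorFunctional ((-x) • evOn V x a) (evOn V y b) t =
        -x * tensorFunctional (evOn V x a) (evOn V y b) t := by
      intro t; simp [tensorFunctional_eq_right]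
    have h2 : ∀ t : ↥V ⊗[ℂ] ↥V, tensorFunctional (evOn V x a) ((-y) • evOn V y b) t =
        -y * tensorFunctional (evOn V x a) (evOn V y b) t := by
      intro t; simp [tensorFunctional_eq_left]
    rw [map_add, tensorFunctional_rTensor, tensorFunctional_lTensor, h, h, h1, h2,
      tensorFunctional_coproduct, tensorFunctional_coproduct, evOn_apply, evOn_apply]
    change ev _ _ ((X : ℂ[X]) • f.1) = _
    rw [ev_smul, Polynomial.eval_X]
    ring
  coskew f := by
    refine tensor_ext_evOn _ _ fun x y a b => ?_
    have hneg : ∀ t : ↥V ⊗[ℂ] ↥V, tensorFunctional (evOn V x a) (evOn V y b) (-t) =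
        -tensorFunctional (evOn V x a) (evOn V y b) t := fun t => map_neg _ t
    rw [tensorFunctional_comm, hneg, tensorFunctional_coproduct, tensorFunctional_coproduct,
      LieConformalAlgebra.skew a b (-x), evOn_apply, evOn_apply]
    have : ∀ (l : ℂ) (c : L), ev l (-c) f.1 = -ev l c f.1 := by
      intro l c; simp [ev_apply]
    rw [this, neg_neg, ev_subst (x + y)]
    simp [add_comm]
  cojacobi f := by
    refine tensor_ext_evOn₃ _ _ fun x y z a b c => ?_
    rw [map_sub, tensorFunctional_leftComm, tensorFunctional_assoc, tensorFunctional_lTensor,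
      tensorFunctional_lTensor, tensorFunctional_rTensor, tensorFunctional_comp_coproduct,
      tensorFunctional_comp_coproduct, tensorFunctional_comp_coproduct,
      tensorFunctional_coproduct, tensorFunctional_coproduct, tensorFunctional_coproduct]
    have hj := LieConformalAlgebra.jacobi a b c (-x) (-y)
    rw [hj, evOn_apply, evOn_apply, evOn_apply, ev_add_left]
    have e1 : y + (x + z) = x + (y + z) := by ring
    have e2 : x + y + z = x + (y + z) := by ring
    have e3 : -(x + y) = -x + -y := by ring
    rw [e1, e2, e3]
    ring

end Coproduct

/-- The differential Lie coalgebra `L⁰`. -/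
instance : DifferentialLieCoalgebra ↥(upperZero L) := goodCoalgebra upperZero_isGood

end UpperZero

/-! ## Current Lie conformal algebras -/

section Current

/-- `Cur V = ℂ[∂] ⊗ V`. -/
abbrev Cur (V : Type*) [AddCommGroup V] [Module ℂ V] : Type _ := ℂ[X] ⊗[ℂ] V

/-- `(f, g) ↦ f(-λ) g(λ + ∂) ∈ ℂ[λ] ⊗ ℂ[∂]`. -/
def curPoly : ℂ[X] →ₗ[ℂ] ℂ[X] →ₗ[ℂ] ℂ[X] ⊗[ℂ] ℂ[X] :=
  (LinearMap.mul ℂ (ℂ[X] ⊗[ℂ] ℂ[X])).compl₁₂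
    (Polynomial.aeval (R := ℂ) ((-X : ℂ[X]) ⊗ₜ[ℂ] (1 : ℂ[X]))).toLinearMap
    (Polynomial.aeval (R := ℂ)
      ((X : ℂ[X]) ⊗ₜ[ℂ] (1 : ℂ[X]) + (1 : ℂ[X]) ⊗ₜ[ℂ] (X : ℂ[X]))).toLinearMap

variable {g : Type*} [LieRing g] [LieAlgebra ℂ g]

variable (g) in
/-- The `λ`-bracket `[f ⊗ a _λ h ⊗ b] = f(-λ) h(λ + ∂) ⊗ [a, b]` on `Cur g`. -/
def curBracket : Cur g →ₗ[ℂ] Cur g →ₗ[ℂ] ℂ[X] ⊗[ℂ] Cur g :=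
  (TensorProduct.map₂ curPoly (LieModule.toEnd ℂ g g : g →ₗ[ℂ] g →ₗ[ℂ] g)).compr₂
    (TensorProduct.assoc ℂ ℂ[X] ℂ[X] g).toLinearMap

lemma curBracket_tmul (f h : ℂ[X]) (a b : g) :
    curBracket g (f ⊗ₜ a) (h ⊗ₜ b) =
      TensorProduct.assoc ℂ ℂ[X] ℂ[X] g (curPoly f h ⊗ₜ[ℂ] ⁅a, b⁆) := by
  simp [curBracket]

lemma subst_assoc (s : ℂ[X]) (u : ℂ[X] ⊗[ℂ] ℂ[X]) (v : g) :
    subst s (TensorProduct.assoc ℂ ℂ[X] ℂ[X] g (u ⊗ₜ[ℂ] v)) =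
      (Algebra.TensorProduct.productMap (Polynomial.aeval (R := ℂ) s) (AlgHom.id ℂ ℂ[X]) u) ⊗ₜ[ℂ]
        v := by
  induction u using TensorProduct.induction_on with
  | zero => simp
  | tmul p q =>
    simp [TensorProduct.smul_tmul', Polynomial.comp, Polynomial.aeval_def]
  | add x y hx hy => simp only [map_add, TensorProduct.add_tmul, hx, hy]

lemma subst_curBracket (s f h : ℂ[X]) (a b : g) :
    subst s (curBracket g (f ⊗ₜ a) (h ⊗ₜ b)) =
      (f.comp (-s) * h.comp (s + X)) ⊗ₜ[ℂ] ⁅a, b⁆ := by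
  rw [curBracket_tmul, subst_assoc]
  congr 1
  simp only [curPoly, LinearMap.compl₁₂_apply, LinearMap.mul_apply', AlgHom.toLinearMap_apply,
    map_mul, ← Polynomial.aeval_algHom_apply]
  simp [Polynomial.comp, Polynomial.aeval_def]

/-- The current Lie conformal algebra `Cur g`. -/
instance : LieConformalAlgebra (Cur g) where
  bracket := curBracket g
  sesq_left a b l := by
    induction a using TensorProduct.induction_on with
    | zero => simp
    | add x y hx hy => simp only [smul_add, map_add, LinearMap.add_apply, hx, hy, neg_add]
    | tmul f a =>
      induction b using TensorProduct.induction_on with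
      | zero => simp
      | add x y hx hy => simp only [smul_add, map_add, hx, hy, neg_add]
      | tmul h b =>
        rw [TensorProduct.smul_tmul', subst_curBracket, subst_curBracket,
          TensorProduct.smul_tmul', ← TensorProduct.neg_tmul]
        congr 1
        simp [Polynomial.smul_eq_C_mul, mul_assoc]
  sesq_right a b l := by
    induction a using TensorProduct.induction_on with
    | zero => simp
    | add x y hx hy => simp only [smul_add, map_add, LinearMap.add_apply, hx, hy]
    | tmul f a =>
      induction b using TensorProduct.induction_on with
      | zero => simp
      | add x y hx hy => simp only [smul_add, map_add, hx, hy]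
      | tmul h b =>
        rw [TensorProduct.smul_tmul', subst_curBracket, subst_curBracket,
          TensorProduct.smul_tmul']
        congr 1
        simp only [smul_eq_mul, Polynomial.mul_comp, Polynomial.X_comp]
        ring
  skew a b l := by
    induction a using TensorProduct.induction_on with
    | zero => simp
    | add x y hx hy => simp only [map_add, LinearMap.add_apply, hx, hy, neg_add]
    | tmul f a =>
      induction b using TensorProduct.induction_on with
      | zero => simp
      | add x y hx hy => simp only [map_add, LinearMap.add_apply, hx, hy, neg_add]
      | tmul h b =>
        rw [subst_curBracket, subst_curBracket, ← lie_skew a b, TensorProduct.tmul_neg,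
          mul_comm]
        congr 3 <;> congr 1 <;> ring
  jacobi a b c l m := by
    induction a using TensorProduct.induction_on with
    | zero => simp
    | add x y hx hy => simp only [map_add, LinearMap.add_apply, hx, hy]; abel
    | tmul f a =>
      induction b using TensorProduct.induction_on with
      | zero => simp
      | add x y hx hy => simp only [map_add, LinearMap.add_apply, hx, hy]; abel
      | tmul h b =>
        induction c using TensorProduct.induction_on with
        | zero => simp
        | add x y hx hy => simp only [map_add, hx, hy]; abel
        | tmul k c =>
          simp only [subst_curBracket]
          rw [leibniz_lie a b c, TensorProduct.tmul_add]
          have e1 : (f.comp (-C l) * (h.comp (-C m) * k.comp (C m + X)).comp (C l + X)) =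
              f.comp (-C l) * h.comp (-C m) * k.comp (C l + C m + X) := by
            simp only [Polynomial.mul_comp, Polynomial.comp_assoc, Polynomial.neg_comp,
              Polynomial.add_comp, Polynomial.C_comp, Polynomial.X_comp]
            rw [← mul_assoc]; congr 2; ring
          have e2 : ((f.comp (-C l) * h.comp (C l + X)).comp (-C (l + m)) *
              k.comp (C (l + m) + X)) =
              f.comp (-C l) * h.comp (-C m) * k.comp (C l + C m + X) := by
            simp only [Polynomial.mul_comp, Polynomial.comp_assoc, Polynomial.neg_comp,
              Polynomial.add_comp, Polynomial.C_comp, Polynomial.X_comp, map_add]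
            congr 3; ring
          have e3 : (h.comp (-C m) * (f.comp (-C l) * k.comp (C l + X)).comp (C m + X)) =
              f.comp (-C l) * h.comp (-C m) * k.comp (C l + C m + X) := by
            simp only [Polynomial.mul_comp, Polynomial.comp_assoc, Polynomial.neg_comp,
              Polynomial.add_comp, Polynomial.C_comp, Polynomial.X_comp]
            rw [← mul_assoc, mul_comm (h.comp _)]; congr 2; ring
          rw [e1, e2, e3]

variable {V : Type*} [AddCommGroup V] [Module ℂ V]

/-- For `φ ∈ V^*`, the element `p(∂) ⊗ v ↦ p(λ) φ(v)` of the conformal dual of `Cur V`. -/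
def thetaBase : Module.Dual ℂ V →ₗ[ℂ] ConformalDual (Cur V) :=
  LinearMap.codRestrict (conformalDualSubmodule (Cur V))
    (LinearMap.compRight ℂ (TensorProduct.rid ℂ ℂ[X]).toLinearMap ∘ₗ
      LinearMap.lTensorHom ℂ[X])
    (fun φ u => by
      simp only [LinearMap.comp_apply, LinearMap.compRight_apply, LinearMap.coe_lTensorHom]
      induction u using TensorProduct.induction_on with
      | zero => simp
      | tmul p v => simp [TensorProduct.smul_tmul']
      | add x y hx hy => simp only [smul_add, map_add, hx, hy, mul_add])

/-- The canonical `ℂ[∂]`-homomorphism `Θ : Cur(V^*) → (Cur V)^{*c}`. -/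
def Theta : Cur (Module.Dual ℂ V) →ₗ[ℂ[X]] ConformalDual (Cur V) :=
  LinearMap.liftBaseChange ℂ[X] thetaBase

/-- `Θ(p(∂) ⊗ φ)_λ (q(∂) ⊗ v) = p(-λ) q(λ) φ(v)`. -/
lemma Theta_apply (p q : ℂ[X]) (φ : Module.Dual ℂ V) (v : V) :
    (Theta (p ⊗ₜ[ℂ] φ)).toLin (q ⊗ₜ[ℂ] v) = p.comp (-X) * q * C (φ v) := by
  have h : (thetaBase φ).toLin (q ⊗ₜ[ℂ] v) = φ v • q := by
    change TensorProduct.rid ℂ ℂ[X] (LinearMap.lTensor ℂ[X] φ (q ⊗ₜ[ℂ] v)) = _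
    simp
  rw [Theta, LinearMap.liftBaseChange_tmul, ConformalDual.toLin_smul, h,
    Polynomial.smul_eq_C_mul]
  ring

end Current

/-! ## Good subspaces of the dual of a Lie algebra -/

section ClassicalGood

variable {g : Type*} [LieRing g] [LieAlgebra ℂ g]

/-- The inclusion `V ⊗ V → (g ⊗ g)^*`. -/
def inclDual (V : Submodule ℂ (Module.Dual ℂ g)) :
    ↥V ⊗[ℂ] ↥V →ₗ[ℂ] Module.Dual ℂ (g ⊗[ℂ] g) :=
  TensorProduct.dualDistrib ℂ g g ∘ₗ TensorProduct.map V.subtype V.subtype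

variable (g) in
/-- The transpose `g^* → (g ⊗ g)^*` of the Lie bracket. -/
def bracketTranspose : Module.Dual ℂ g →ₗ[ℂ] Module.Dual ℂ (g ⊗[ℂ] g) :=
  Module.Dual.transpose
    (TensorProduct.lift (LieModule.toEnd ℂ g g : g →ₗ[ℂ] g →ₗ[ℂ] g))

lemma bracketTranspose_apply (f : Module.Dual ℂ g) (a b : g) :
    bracketTranspose g f (a ⊗ₜ b) = f ⁅a, b⁆ := by
  simp [bracketTranspose, Module.Dual.transpose_apply]

/-- A subspace `V ⊆ g^*` is good if the transpose of the bracket maps `V` into `V ⊗ V`. -/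
def IsGoodSubspace (V : Submodule ℂ (Module.Dual ℂ g)) : Prop :=
  ∀ f ∈ V, bracketTranspose g f ∈ LinearMap.range (inclDual V)

variable {V : Submodule ℂ (Module.Dual ℂ g)}

lemma inclDual_injective : Function.Injective (inclDual V) := by
  rw [injective_iff_map_eq_zero]
  intro t ht
  refine tensor_eq_zero_of_separating
    (fun a : g => Module.Dual.eval ℂ g a ∘ₗ V.subtype)
    (fun a : g => Module.Dual.eval ℂ g a ∘ₗ V.subtype)
    (fun f hf => Subtype.ext (LinearMap.ext hf)) (fun f hf => Subtype.ext (LinearMap.ext hf))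
    t fun a b => ?_
  have key : ∀ u : ↥V ⊗[ℂ] ↥V, tensorFunctional (Module.Dual.eval ℂ g a ∘ₗ V.subtype)
      (Module.Dual.eval ℂ g b ∘ₗ V.subtype) u = inclDual V u (a ⊗ₜ b) := by
    intro u
    induction u using TensorProduct.induction_on with
    | zero => simp
    | tmul x y => simp [inclDual]
    | add x y hx hy => simp only [map_add, LinearMap.add_apply, hx, hy]
  rw [key, ht, LinearMap.zero_apply]

/-- The coproduct `δ_V : V → V ⊗ V` of a good subspace, the restriction of the transpose of the
bracket. -/
def goodCoproduct (hV : IsGoodSubspace V) : ↥V →ₗ[ℂ] ↥V ⊗[ℂ] ↥V :=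
  (LinearEquiv.ofInjective (inclDual V) inclDual_injective).symm.toLinearMap ∘ₗ
    ((bracketTranspose g).domRestrict V).codRestrict (LinearMap.range (inclDual V))
      (fun f => hV f.1 f.2)

lemma inclDual_goodCoproduct (hV : IsGoodSubspace V) (f : ↥V) :
    inclDual V (goodCoproduct hV f) = bracketTranspose g f.1 := by
  have := congrArg Subtype.val
    ((LinearEquiv.ofInjective (inclDual V) inclDual_injective).apply_symm_apply
      (((bracketTranspose g).domRestrict V).codRestrict (LinearMap.range (inclDual V))
        (fun f => hV f.1 f.2) f))
  exact this

end ClassicalGood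

/-! ## The example -/

section Example

/-- The vector space `⊕_{i ≥ 0} ℂ e_i`. -/
def ShiftLie : Type := ℕ →₀ ℂ

namespace ShiftLie

instance : AddCommGroup ShiftLie := inferInstanceAs (AddCommGroup (ℕ →₀ ℂ))

instance : Module ℂ ShiftLie := inferInstanceAs (Module ℂ (ℕ →₀ ℂ))

/-- The basis vector `e_i`. -/
def e (i : ℕ) : ShiftLie := Finsupp.single i (1 : ℂ)

/-- The coordinate functional `e_i^*`, with `e_i^*(e_j) = δ_{ij}`. -/
def eStar (i : ℕ) : Module.Dual ℂ ShiftLie := (Finsupp.lapply i : (ℕ →₀ ℂ) →ₗ[ℂ] ℂ)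

lemma eStar_e (i j : ℕ) : eStar i (e j) = if i = j then 1 else 0 := by
  simp only [eStar, e]
  exact (Finsupp.single_apply).trans (by simp [eq_comm])

/-- The linear map with `e_k ↦ e_{k-1}` for `k ≥ 2` and `e_0, e_1 ↦ 0`. -/
def shift : ShiftLie →ₗ[ℂ] ShiftLie :=
  Finsupp.linearCombination ℂ (fun k : ℕ => if 2 ≤ k then e (k - 1) else 0)

lemma shift_e (k : ℕ) : shift (e k) = if 2 ≤ k then e (k - 1) else 0 :=
  (Finsupp.linearCombination_single ℂ 1 k).trans (one_smul ℂ _)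

lemma eStar_zero_shift (x : ShiftLie) : eStar 0 (shift x) = 0 := by
  have : eStar 0 ∘ₗ shift = 0 := by
    refine Finsupp.lhom_ext' fun k => LinearMap.ext_ring ?_
    change eStar 0 (shift (e k)) = 0
    rw [shift_e]
    split_ifs with h
    · rw [eStar_e, if_neg (by omega)]
    · simp
  exact LinearMap.congr_fun this x

/-- The bracket is determined by `[e_0, e_k] = e_{k-1}` for `k ≥ 2`, `[e_0, e_1] = 0` and
`[e_j, e_k] = 0` for `j, k ≥ 1`, see `lie_e`. -/
instance : LieRing ShiftLie where
  bracket x y := eStar 0 x • shift y - eStar 0 y • shift x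
  add_lie x y z := by
    change eStar 0 (x + y) • shift z - eStar 0 z • shift (x + y) =
      (eStar 0 x • shift z - eStar 0 z • shift x) + (eStar 0 y • shift z - eStar 0 z • shift y)
    simp only [map_add]; module
  lie_add x y z := by
    change eStar 0 x • shift (y + z) - eStar 0 (y + z) • shift x =
      (eStar 0 x • shift y - eStar 0 y • shift x) + (eStar 0 x • shift z - eStar 0 z • shift x)
    simp only [map_add]; module
  lie_self x := sub_self _
  leibniz_lie x y z := by
    change eStar 0 x • shift (eStar 0 y • shift z - eStar 0 z • shift y) -
        eStar 0 (eStar 0 y • shift z - eStar 0 z • shift y) • shift x =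
      (eStar 0 (eStar 0 x • shift y - eStar 0 y • shift x) • shift z -
        eStar 0 z • shift (eStar 0 x • shift y - eStar 0 y • shift x)) +
      (eStar 0 y • shift (eStar 0 x • shift z - eStar 0 z • shift x) -
        eStar 0 (eStar 0 x • shift z - eStar 0 z • shift x) • shift y)
    simp only [map_sub, map_smul, eStar_zero_shift, smul_zero, sub_zero, zero_smul]
    module

lemma lie_def (x y : ShiftLie) : ⁅x, y⁆ = eStar 0 x • shift y - eStar 0 y • shift x := rfl

instance : LieAlgebra ℂ ShiftLie where
  lie_smul c x y := by
    simp only [lie_def, map_smul, smul_eq_mul]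
    module

/-- The bracket on basis vectors. -/
lemma lie_e (j k : ℕ) : ⁅e j, e k⁆ =
    if j = 0 ∧ 2 ≤ k then e (k - 1)
    else if k = 0 ∧ 2 ≤ j then -e (j - 1)
    else 0 := by
  rw [lie_def, eStar_e, eStar_e, shift_e, shift_e]
  split_ifs <;> first | omega | simp

/-- `J_a = (a(∂)ℂ[∂] ⊗ e_0) ⊕ (⊕_{i ≥ 1} ℂ[∂] ⊗ e_i)`. -/
def J (a : ℂ[X]) : Submodule ℂ[X] (Cur ShiftLie) :=
  Submodule.span ℂ[X] {a ⊗ₜ[ℂ] e 0} ⊔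
    ⨆ i : ℕ, Submodule.span ℂ[X] {(1 : ℂ[X]) ⊗ₜ[ℂ] e (i + 1)}

/-- The subspace `⊕_{i ≥ 0} ℂ e_i^*` of `g^*`. -/
def restrictedDual : Submodule ℂ (Module.Dual ℂ ShiftLie) :=
  Submodule.span ℂ (Set.range eStar)

/-- `e_i^*` as an element of `⊕_{i ≥ 0} ℂ e_i^*`. -/
def eStarR (i : ℕ) : ↥restrictedDual :=
  ⟨eStar i, Submodule.subset_span (Set.mem_range_self i)⟩

end ShiftLie

end Example

end

end ConformalAlg

open ConformalAlg ConformalAlg.ShiftLie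

/-! The engine is a degree-lowering argument. In `Cur g` one has `[1 ⊗ e_0 _λ p ⊗ v] = p(λ + ∂) ⊗
[e_0, v]`, so by Taylor expansion the coefficient of `λ^j` is the `j`-th Hasse derivative of `p`
tensored with the shift of `v`. An ideal contains all these coefficients (`IsIdeal.hasseDeriv_mem`).

Let `I` be an ideal of cofinite rank. For each `i`, the classes of `e_{i+2}, e_{i+3}, …` are
dependent over `ℂ[∂]`, which gives a nonzero combination in `I`. The Hasse derivative of the maximal
degree turns it into a nonzero constant vector `1 ⊗ w` in `I`, and repeated shifts of `w` yield
`e_1, …, e_{i+1}` (`tmul_e_succ_mem_of_cofiniteRank`). Hence `I` is determined by its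
`e_0`-coordinates, an ideal of the principal ideal domain `ℂ[∂]`. Conversely, every `J a` is an
ideal because no bracket has an `e_0`-component.

For the locally finite part, the common kernel of a finite-rank subcoalgebra is an ideal
(`isIdeal_conformalAnnihilator`) of cofinite rank (`cofiniteRank_conformalAnnihilator`). It
therefore contains all `e_i` with `i ≥ 1`, so every functional in the subcoalgebra is determined by
its value at `e_0` and is a multiple of `e_0^*`. Conversely, `ℂ[∂] e_0^*` is a subcoalgebra with
zero coproduct.

Finally, `e_i^*([x, y]) = e_0^*(x) e_{i+1}^*(y) - e_{i+1}^*(x) e_0^*(y)` for `i ≥ 1`. This is the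
coproduct on the restricted dual, and its conformal version puts every `Θ(1 ⊗ e_i^*)` into the upper
zero. Since `Θ(1 ⊗ e_1^*)` is not a multiple of `Θ(1 ⊗ e_0^*)`, the locally finite part is proper.
-/

namespace ConformalAlg

/-! ### Membership in `ℂ[λ] ⊗ J`, by values and by coefficients -/

section Ideals

variable {L : Type*} [AddCommGroup L] [Module ℂ L] [Module ℂ[X] L] [IsScalarTower ℂ ℂ[X] L]

lemma map_subst {L' : Type*} [AddCommGroup L'] [Module ℂ L'] [Module ℂ[X] L']
    [IsScalarTower ℂ ℂ[X] L'] (F : L →ₗ[ℂ[X]] L') (s : ℂ[X]) (t : ℂ[X] ⊗[ℂ] L) :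
    subst s (LinearMap.lTensor ℂ[X] (F.restrictScalars ℂ) t) = F (subst s t) := by
  induction t using TensorProduct.induction_on with
  | zero => simp
  | tmul p v => simp
  | add x y hx hy => simp only [map_add, hx, hy]

/-- An element of `ℂ[λ] ⊗ L` lies in `ℂ[λ] ⊗ J` iff all its values lie in `J`. -/
lemma mem_range_lTensor_iff (J : Submodule ℂ[X] L) (t : ℂ[X] ⊗[ℂ] L) :
    t ∈ LinearMap.range (LinearMap.lTensor ℂ[X] (J.subtype.restrictScalars ℂ)) ↔
      ∀ z : ℂ, subst (C z) t ∈ J := by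
  constructor
  · rintro ⟨t, rfl⟩ z
    rw [map_subst]
    exact (subst (C z) t).2
  · intro h
    -- By right exactness of `ℂ[λ] ⊗ -` it is enough that `t` vanishes in `ℂ[λ] ⊗ L/J`, which can be
    -- tested on values.
    have hex : Function.Exact (J.subtype.restrictScalars ℂ) (J.mkQ.restrictScalars ℂ) :=
      fun x => by simp
    refine ((lTensor_exact ℂ[X] hex J.mkQ_surjective) t).1 (ext_of_subst _ _ fun z => ?_)
    rw [map_subst, map_zero]
    simpa using h z

/-- The coefficient of `λ^j` of an element of `ℂ[λ] ⊗ L`. -/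
noncomputable def lambdaCoeff (L : Type*) [AddCommGroup L] [Module ℂ L] (j : ℕ) :
    ℂ[X] ⊗[ℂ] L →ₗ[ℂ] L :=
  (TensorProduct.lid ℂ L).toLinearMap ∘ₗ LinearMap.rTensor L (Polynomial.lcoeff ℂ j)

omit [Module ℂ[X] L] [IsScalarTower ℂ ℂ[X] L] in
@[simp] lemma lambdaCoeff_tmul (j : ℕ) (p : ℂ[X]) (v : L) :
    lambdaCoeff L j (p ⊗ₜ v) = p.coeff j • v := by
  simp [lambdaCoeff]

lemma lambdaCoeff_mem (J : Submodule ℂ[X] L) (j : ℕ) {t : ℂ[X] ⊗[ℂ] L}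
    (ht : t ∈ LinearMap.range (LinearMap.lTensor ℂ[X] (J.subtype.restrictScalars ℂ))) :
    lambdaCoeff L j t ∈ J := by
  obtain ⟨t, rfl⟩ := ht
  induction t using TensorProduct.induction_on with
  | zero => simp
  | tmul p v => simpa using J.smul_of_tower_mem _ v.2
  | add x y hx hy => simpa only [map_add] using J.add_mem hx hy

end Ideals

/-! ### Coefficients of the bracket in a current algebra -/

section Current

variable {g : Type*} [LieRing g] [LieAlgebra ℂ g]

/-- Taylor's formula: the coefficient of `λ^j` in `p(λ + ∂)` is `p^{(j)}(∂)/j!`. -/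
lemma lambdaCoeff_curPoly_one (j : ℕ) (p : ℂ[X]) :
    lambdaCoeff ℂ[X] j (curPoly 1 p) = hasseDeriv j p := by
  induction p using Polynomial.induction_on' with
  | add p q hp hq => simp only [map_add, hp, hq]
  | monomial n c =>
    have h : curPoly 1 (monomial n c) = c • ∑ m ∈ Finset.range (n + 1),
        (((X : ℂ[X]) ^ m) ⊗ₜ[ℂ] ((X : ℂ[X]) ^ (n - m) * (n.choose m : ℂ[X]))) := by
      simp only [curPoly, LinearMap.compl₁₂_apply, LinearMap.mul_apply',
        AlgHom.toLinearMap_apply, map_one, one_mul, aeval_monomial, ← Algebra.smul_def]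
      rw [add_pow]
      congr 1
      refine Finset.sum_congr rfl fun m _ => ?_
      have hc : (Nat.cast (n.choose m) : ℂ[X] ⊗[ℂ] ℂ[X]) = (1 : ℂ[X]) ⊗ₜ[ℂ] (n.choose m : ℂ[X]) :=
        (map_natCast (Algebra.TensorProduct.includeRight : ℂ[X] →ₐ[ℂ] ℂ[X] ⊗[ℂ] ℂ[X]) _).symm
      rw [Algebra.TensorProduct.tmul_pow, Algebra.TensorProduct.tmul_pow,
        Algebra.TensorProduct.tmul_mul_tmul, hc, Algebra.TensorProduct.tmul_mul_tmul]
      simp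
    rw [h, hasseDeriv_monomial]
    simp only [map_smul, map_sum, lambdaCoeff_tmul, coeff_X_pow, ite_smul, one_smul, zero_smul,
      Finset.sum_ite_eq, Finset.mem_range]
    split_ifs with hj
    · rw [← C_mul_X_pow_eq_monomial, smul_eq_C_mul]
      simp only [map_mul, map_natCast]
      ring
    -- For `j > n` the binomial sum has no `λ^j` term, and the Hasse derivative vanishes as well.
    · rw [Nat.choose_eq_zero_of_lt (by omega)]
      simp

lemma lambdaCoeff_assoc (j : ℕ) (t : ℂ[X] ⊗[ℂ] ℂ[X]) (v : g) :
    lambdaCoeff (Cur g) j (TensorProduct.assoc ℂ ℂ[X] ℂ[X] g (t ⊗ₜ v)) =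
      lambdaCoeff ℂ[X] j t ⊗ₜ v := by
  induction t using TensorProduct.induction_on with
  | zero => simp
  | tmul p q => simp [TensorProduct.smul_tmul']
  | add x y hx hy => simp only [map_add, TensorProduct.add_tmul, hx, hy]

lemma lambdaCoeff_curBracket (j : ℕ) (a : g) (u : Cur g) :
    lambdaCoeff (Cur g) j (curBracket g (1 ⊗ₜ a) u) =
      TensorProduct.map (hasseDeriv j) (LieModule.toEnd ℂ g g a) u := by
  induction u using TensorProduct.induction_on with
  | zero => simp
  | tmul p v => rw [curBracket_tmul, lambdaCoeff_assoc, lambdaCoeff_curPoly_one]; simp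
  | add x y hx hy => simp only [map_add, hx, hy]

/-- Read off the coefficient of `λ^j` in `[1 ⊗ a _λ u]`. This lowers degrees in `∂` without leaving
the ideal. -/
lemma IsIdeal.hasseDeriv_mem {I : Submodule ℂ[X] (Cur g)} (hI : IsIdeal I) (j : ℕ) (a : g)
    {u : Cur g} (hu : u ∈ I) :
    TensorProduct.map (hasseDeriv j) (LieModule.toEnd ℂ g g a) u ∈ I := by
  rw [← lambdaCoeff_curBracket]
  exact lambdaCoeff_mem I j (hI _ u hu).1

/-- Only the bound `≤ d` is required, so one order `d` makes several polynomials constant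
simultaneously; those of smaller degree become `0`. -/
lemma hasseDeriv_eq_C {p : ℂ[X]} {d : ℕ} (h : p.natDegree ≤ d) :
    hasseDeriv d p = C (p.coeff d) := by
  ext n
  rw [hasseDeriv_coeff, coeff_C]
  split_ifs with hn
  · simp [hn]
  · rw [coeff_eq_zero_of_natDegree_lt (by omega), mul_zero]

end Current

/-! ### Ideals of cofinite rank of `Cur g` -/

namespace ShiftLie

lemma ext_eStar {x y : ShiftLie} (h : ∀ i, eStar i x = eStar i y) : x = y := Finsupp.ext h

lemma shiftLie_induction {P : ShiftLie → Prop} (x : ShiftLie) (h0 : P 0)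
    (hadd : ∀ x y, P x → P y → P (x + y)) (he : ∀ i (c : ℂ), P (c • e i)) : P x := by
  refine Finsupp.induction_linear (motive := P) x h0 hadd fun i c => ?_
  have := he i c
  rwa [show c • e i = (Finsupp.single i c : ℕ →₀ ℂ) from
    (Finsupp.smul_single c i (1 : ℂ)).trans (by simp)] at this

/-- The case `i = 0` is excluded because `shift` kills `e_1` instead of sending it to `e_0`. -/
lemma eStar_shift {i : ℕ} (hi : 1 ≤ i) (x : ShiftLie) : eStar i (shift x) = eStar (i + 1) x := by
  induction x using shiftLie_induction with
  | h0 => simp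
  | hadd x y hx hy => simp only [map_add, hx, hy]
  | he k c =>
    simp only [map_smul, shift_e, eStar_e]
    congr 1
    split_ifs with h1 h2 h2
    · rw [eStar_e, if_pos (by omega)]
    · rw [eStar_e, if_neg (by omega)]
    · omega
    · simp

lemma lie_e_zero (x : ShiftLie) : ⁅e 0, x⁆ = shift x := by
  rw [lie_def, eStar_e, if_pos rfl, one_smul]
  have : shift (e 0) = 0 := by rw [shift_e, if_neg (by omega)]
  rw [this, smul_zero, sub_zero]

lemma eStar_zero_lie (x y : ShiftLie) : eStar 0 ⁅x, y⁆ = 0 := by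
  simp [lie_def, eStar_zero_shift]

/-- A shift-invariant subspace containing a vector `∑_{1 ≤ i ≤ n} c_i e_i` with `c_n ≠ 0`
contains `e_1, …, e_n`. -/
lemma e_mem_of_shift_invariant {W : Submodule ℂ ShiftLie} (hW : ∀ x ∈ W, shift x ∈ W) (n : ℕ)
    (w : ShiftLie) (hw : w ∈ W) (h0 : eStar 0 w = 0) (hn : eStar n w ≠ 0)
    (hlt : ∀ i, n < i → eStar i w = 0) : ∀ i, 1 ≤ i → i ≤ n → e i ∈ W := by
  induction n generalizing w with
  | zero => exact absurd h0 hn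
  | succ n ih =>
    -- The shift of `w` has top index `n`, so the induction hypothesis gives all lower basis
    -- vectors.
    have hlow : ∀ i, 1 ≤ i → i ≤ n → e i ∈ W := by
      intro i h1 hi
      refine ih (shift w) (hW w hw) (eStar_zero_shift w) ?_ ?_ i h1 hi
      · rwa [eStar_shift (by omega)]
      · intro i hi
        rw [eStar_shift (by omega)]
        exact hlt _ (by omega)
    -- Removing the lower terms of `w`, already known to lie in `W`, isolates its top term.
    have hsum : eStar (n + 1) w • e (n + 1) =
        w - ∑ i ∈ Finset.range n, eStar (i + 1) w • e (i + 1) := by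
      rw [eq_sub_iff_add_eq, add_comm, ← Finset.sum_range_succ (fun i => eStar (i + 1) w • e (i + 1))]
      refine ext_eStar fun k => ?_
      simp only [map_sum, map_smul, eStar_e, smul_eq_mul, mul_ite, mul_one, mul_zero]
      rcases k with - | k
      · simp [h0]
      · rw [Finset.sum_eq_single k (fun b _ hb => if_neg (by omega))]
        · simp
        · intro hk
          rw [if_pos rfl]
          exact hlt _ (by simpa using hk)
    intro i h1 hi
    rcases hi.lt_or_eq with hi | rfl
    · exact hlow i h1 (by omega)
    · rw [← Submodule.smul_mem_iff W hn, hsum]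
      refine W.sub_mem hw (W.sum_mem fun j hj => W.smul_mem _ (hlow _ (by omega) ?_))
      have := Finset.mem_range.1 hj
      omega

/-- The `ℂ[∂]`-linear coordinate `p ⊗ v ↦ e_i^*(v) p` on `Cur g`. -/
noncomputable def coord (i : ℕ) : Cur ShiftLie →ₗ[ℂ[X]] ℂ[X] :=
  Module.Dual.baseChange ℂ[X] (eStar i)

@[simp] lemma coord_tmul (i : ℕ) (p : ℂ[X]) (v : ShiftLie) :
    coord i (p ⊗ₜ v) = eStar i v • p := by
  simp [coord, Module.Dual.baseChange_apply_tmul, Algebra.smul_def, mul_comm]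

/-- Modulo the `e_i` with `i ≥ 1`, everything is a `ℂ[∂]`-multiple of `e_0`. The submodule is
arbitrary because this serves `J a`, ideals of cofinite rank and annihilators alike. -/
lemma sub_coord_smul_mem {I : Submodule ℂ[X] (Cur ShiftLie)}
    (hI : ∀ i, (1 : ℂ[X]) ⊗ₜ[ℂ] e (i + 1) ∈ I) (u : Cur ShiftLie) :
    u - coord 0 u • ((1 : ℂ[X]) ⊗ₜ[ℂ] e 0) ∈ I := by
  induction u using TensorProduct.induction_on with
  | zero => simp
  | add x y hx hy =>
    rw [map_add, add_smul, add_sub_add_comm]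
    exact I.add_mem hx hy
  | tmul p v =>
    induction v using shiftLie_induction with
    | h0 => simp
    | hadd x y hx hy =>
      rw [TensorProduct.tmul_add, map_add, add_smul, add_sub_add_comm]
      exact I.add_mem hx hy
    | he i c =>
      have h : p ⊗ₜ[ℂ] (c • e i) = (c • p) • ((1 : ℂ[X]) ⊗ₜ[ℂ] e i) := by
        rw [TensorProduct.smul_tmul' (c • p), smul_eq_mul, mul_one, TensorProduct.smul_tmul]
      rw [coord_tmul, h]
      rcases i with - | i
      · rw [map_smul, eStar_e, if_pos rfl, smul_eq_mul, mul_one, sub_self]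
        exact I.zero_mem
      · rw [map_smul, eStar_e, if_neg (by omega), smul_zero, zero_smul, zero_smul, sub_zero]
        exact I.smul_mem _ (hI i)

lemma mem_of_coord_zero {I : Submodule ℂ[X] (Cur ShiftLie)}
    (hI : ∀ i, (1 : ℂ[X]) ⊗ₜ[ℂ] e (i + 1) ∈ I) {u : Cur ShiftLie} (hu : coord 0 u = 0) :
    u ∈ I := by
  simpa [hu] using sub_coord_smul_mem hI u

lemma tmul_e_succ_mem_J (a : ℂ[X]) (i : ℕ) : (1 : ℂ[X]) ⊗ₜ[ℂ] e (i + 1) ∈ J a :=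
  Submodule.mem_sup_right (Submodule.mem_iSup_of_mem i (Submodule.mem_span_singleton_self _))

/-- `J a` is the preimage of the ideal `(a)` under the `e_0`-coordinate, which turns questions about
it into divisibility. -/
lemma mem_J_iff (a : ℂ[X]) (u : Cur ShiftLie) : u ∈ J a ↔ a ∣ coord 0 u := by
  constructor
  · have : J a ≤ Submodule.comap (coord 0) (Ideal.span {a}) := by
      refine sup_le ?_ (iSup_le fun i => ?_)
      · rw [Submodule.span_le, Set.singleton_subset_iff]
        simp [eStar_e]
      · rw [Submodule.span_le, Set.singleton_subset_iff]
        simp [eStar_e]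
    intro hu
    exact Ideal.mem_span_singleton.1 (this hu)
  · rintro ⟨q, hq⟩
    have h := sub_coord_smul_mem (tmul_e_succ_mem_J a) u
    rw [← Submodule.sub_mem_iff_left _ ?_]
    · exact h
    · have : a ⊗ₜ[ℂ] e 0 ∈ J a := Submodule.mem_sup_left (Submodule.mem_span_singleton_self _)
      have h2 := (J a).smul_mem q this
      rw [hq]
      rw [TensorProduct.smul_tmul', smul_eq_mul, mul_comm] at h2
      rwa [TensorProduct.smul_tmul', smul_eq_mul, mul_one]

/-- The derived algebra of `g` has no `e_0`-component. -/
lemma coord_zero_subst_bracket (a b : Cur ShiftLie) (l : ℂ) :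
    coord 0 (subst (C l) (LieConformalAlgebra.bracket a b)) = 0 := by
  induction a using TensorProduct.induction_on with
  | zero => simp
  | add x y hx hy => simp only [map_add, LinearMap.add_apply, hx, hy, add_zero]
  | tmul f x =>
    induction b using TensorProduct.induction_on with
    | zero => simp
    | add x y hx hy => simp only [map_add, hx, hy, add_zero]
    | tmul h y =>
      change coord 0 (subst (C l) (curBracket ShiftLie _ _)) = 0
      rw [subst_curBracket, coord_tmul, eStar_zero_lie, zero_smul]

lemma isIdeal_J (a : ℂ[X]) : IsIdeal (J a) := by
  intro x y _
  simp only [mem_range_lTensor_iff, mem_J_iff, coord_zero_subst_bracket, dvd_zero, implies_true,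
    and_self]

lemma cofiniteRank_J (a : ℂ[X]) : CofiniteRank (J a) := by
  have : Module.Finite ℂ[X] (Cur ShiftLie ⧸ J a) := by
    refine ⟨⟨{(J a).mkQ ((1 : ℂ[X]) ⊗ₜ[ℂ] e 0)}, ?_⟩⟩
    rw [eq_top_iff]
    rintro x -
    obtain ⟨u, rfl⟩ := (J a).mkQ_surjective x
    rw [Finset.coe_singleton, Submodule.mem_span_singleton]
    refine ⟨coord 0 u, ?_⟩
    rw [← map_smul, eq_comm, ← sub_eq_zero, ← map_sub, ← LinearMap.mem_ker, Submodule.ker_mkQ]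
    exact sub_coord_smul_mem (tmul_e_succ_mem_J a) u
  exact Module.rank_lt_aleph0 _ _

/-- Ideals of cofinite rank contain all `e_i` with `i ≥ 1`. -/
lemma tmul_e_succ_mem_of_cofiniteRank {I : Submodule ℂ[X] (Cur ShiftLie)} (hI : IsIdeal I)
    (hr : CofiniteRank I) (i : ℕ) : (1 : ℂ[X]) ⊗ₜ[ℂ] e (i + 1) ∈ I := by
  classical
  -- Starting at index `i + 2` ensures that one bracket with `e_0` kills no term and leaves only
  -- indices at least `i + 1`.
  have hdep : ¬ LinearIndependent ℂ[X]
      (fun k : ℕ => I.mkQ ((1 : ℂ[X]) ⊗ₜ[ℂ] e (k + (i + 2)))) := fun h => by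
    have := h.aleph0_le_rank
    exact absurd hr (not_lt.2 this)
  rw [linearIndependent_iff] at hdep
  push Not at hdep
  obtain ⟨p, hp, hp0⟩ := hdep
  have hmem : p.sum (fun k q => q ⊗ₜ[ℂ] e (k + (i + 2))) ∈ I := by
    rw [← Submodule.ker_mkQ I, LinearMap.mem_ker, ← hp, Finsupp.linearCombination_apply,
      Finsupp.sum, Finsupp.sum, map_sum]
    refine Finset.sum_congr rfl fun k _ => ?_
    rw [← map_smul, TensorProduct.smul_tmul', smul_eq_mul, mul_one]
  obtain ⟨k₀, hk₀, hmax⟩ := p.support.exists_max_image (fun k => (p k).natDegree)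
    (Finsupp.support_nonempty_iff.2 hp0)
  set d := (p k₀).natDegree with hd
  have hmem' := hI.hasseDeriv_mem d (e 0) hmem
  -- The order `d` is the maximal degree of the coefficients, so only their constants `(p k).coeff
  -- d` survive, and the one at `k₀` is nonzero.
  have hW : (1 : ℂ[X]) ⊗ₜ[ℂ] (∑ k ∈ p.support, (p k).coeff d • e (k + (i + 1))) ∈ I := by
    convert hmem' using 1
    rw [Finsupp.sum, map_sum, TensorProduct.tmul_sum]
    refine Finset.sum_congr rfl fun k hk => ?_
    rw [TensorProduct.map_tmul, hasseDeriv_eq_C (hmax k hk), LieModule.toEnd_apply_apply,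
      lie_e_zero, shift_e, if_pos (by omega), ← TensorProduct.smul_tmul, smul_eq_C_mul, mul_one]
    rfl
  set w := ∑ k ∈ p.support, (p k).coeff d • e (k + (i + 1)) with hw
  have hwc : ∀ k, eStar (k + (i + 1)) w = (p k).coeff d := by
    intro k
    simp only [hw, map_sum, map_smul, eStar_e, smul_eq_mul, mul_ite, mul_one, mul_zero,
      add_left_inj, Finset.sum_ite_eq]
    split_ifs with h
    · rfl
    · simp [Finsupp.notMem_support_iff.1 h]
  have hwl : ∀ k, k < i + 1 → eStar k w = 0 := by
    intro k hk
    simp only [hw, map_sum, map_smul, eStar_e]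
    exact Finset.sum_eq_zero fun j _ => by rw [if_neg (by omega), smul_zero]
  have hne : (p.support.filter fun k => (p k).coeff d ≠ 0).Nonempty :=
    ⟨k₀, Finset.mem_filter.2 ⟨hk₀, by
      rw [hd, coeff_natDegree, leadingCoeff_ne_zero]
      exact Finsupp.mem_support_iff.1 hk₀⟩⟩
  -- The top index of `w` is `n + (i + 1)`.
  obtain ⟨n, hn, hnmax⟩ := Finset.exists_max_image _ id hne
  let W : Submodule ℂ ShiftLie :=
    (I.restrictScalars ℂ).comap (TensorProduct.mk ℂ ℂ[X] ShiftLie 1)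
  have hshift : ∀ x ∈ W, shift x ∈ W := by
    intro x hx
    have := hI.hasseDeriv_mem 0 (e 0) (u := (1 : ℂ[X]) ⊗ₜ[ℂ] x) hx
    rw [TensorProduct.map_tmul, hasseDeriv_zero, LieModule.toEnd_apply_apply, lie_e_zero] at this
    exact this
  refine e_mem_of_shift_invariant hshift (n + (i + 1)) w hW (hwl 0 (by omega)) ?_ ?_ (i + 1)
    (by omega) (by omega)
  · rw [hwc]
    exact (Finset.mem_filter.1 hn).2
  · intro j hj
    obtain ⟨k, rfl⟩ : ∃ k, j = k + (i + 1) := ⟨j - (i + 1), by omega⟩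
    rw [hwc]
    by_contra hk
    have hks : k ∈ p.support := by
      rw [Finsupp.mem_support_iff]
      rintro h
      simp [h] at hk
    have := hnmax k (Finset.mem_filter.2 ⟨hks, hk⟩)
    simp only [id] at this
    omega

lemma isIdeal_cofiniteRank_iff (I : Submodule ℂ[X] (Cur ShiftLie)) :
    (IsIdeal I ∧ CofiniteRank I ∧ I ≠ ⊥ ∧ I ≠ ⊤) ↔ ∃ a : ℂ[X], ¬ IsUnit a ∧ I = J a := by
  constructor
  · rintro ⟨hI, hr, -, htop⟩
    have he := tmul_e_succ_mem_of_cofiniteRank hI hr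
    -- The generator of the ideal of `e_0`-coordinates of `I`.
    obtain ⟨a, ha⟩ := (IsPrincipalIdealRing.principal (I.map (coord 0))).principal
    have hIJ : I = J a := by
      ext u
      rw [mem_J_iff, ← Ideal.mem_span_singleton, Ideal.span, ← ha]
      constructor
      · exact Submodule.mem_map_of_mem
      · rintro ⟨v, hv, hvu⟩
        have : u - v ∈ I := mem_of_coord_zero he (by rw [map_sub, hvu, sub_self])
        exact (Submodule.sub_mem_iff_left I hv).1 this
    refine ⟨a, fun hu => htop ?_, hIJ⟩
    rw [hIJ, eq_top_iff]
    exact fun u _ => (mem_J_iff a u).2 hu.dvd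
  · rintro ⟨a, ha, rfl⟩
    refine ⟨isIdeal_J a, cofiniteRank_J a, fun h => ?_, fun h => ha ?_⟩
    · have := tmul_e_succ_mem_J a 0
      rw [h, Submodule.mem_bot] at this
      have h1 := congrArg (coord 1) this
      simp [eStar_e] at h1
    · have : (1 : ℂ[X]) ⊗ₜ[ℂ] e 0 ∈ J a := h ▸ Submodule.mem_top
      rw [mem_J_iff] at this
      simpa [eStar_e, isUnit_iff_dvd_one] using this

end ShiftLie

/-! ### Goodness in terms of values -/

section Good

lemma tensorFunctional_eq_zero_of_mem_range {M : Type*} [AddCommGroup M] [Module ℂ M]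
    [Module ℂ[X] M] [IsScalarTower ℂ ℂ[X] M] {N : Submodule ℂ[X] M} {φ ψ : M →ₗ[ℂ] ℂ}
    (h : (∀ f ∈ N, φ f = 0) ∨ ∀ f ∈ N, ψ f = 0) {t : M ⊗[ℂ] M}
    (ht : t ∈ LinearMap.range
      (TensorProduct.map (N.subtype.restrictScalars ℂ) (N.subtype.restrictScalars ℂ))) :
    tensorFunctional φ ψ t = 0 := by
  obtain ⟨t, rfl⟩ := ht
  induction t using TensorProduct.induction_on with
  | zero => simp
  | tmul x y =>
    rw [TensorProduct.map_tmul, tensorFunctional_tmul, mul_eq_zero]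
    exact h.imp (fun h => h _ x.2) fun h => h _ y.2
  | add x y hx hy => simp only [map_add, hx, hy, add_zero]

variable {L : Type*} [AddCommGroup L] [Module ℂ L] [Module ℂ[X] L] [IsScalarTower ℂ ℂ[X] L]
  [LieConformalAlgebra L]

/-- The coproduct condition of `IsGood` at `f`, in terms of values. -/
lemma piMap_eq_phiMap_iff {V : Submodule ℂ[X] (ConformalDual L)} (f : ConformalDual L)
    (t : ↥V ⊗[ℂ] ↥V) :
    (∀ m : ℂ, piMap m f = phiMap (-m) (inclTensor V t)) ↔
      ∀ (x y : ℂ) (a b : L), ev (x + y) (subst (C (-x)) (LieConformalAlgebra.bracket a b)) f =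
        tensorFunctional (evOn V x a) (evOn V y b) t := by
  constructor
  · intro h x y a b
    -- Here `μ = -x` and the outer variable is `x + y`, so the two tensor factors are evaluated at
    -- `x` and `y`.
    have := congrFun (congrFun (congrFun (h (-x)) (x + y)) a) b
    rwa [phiMap_inclTensor, neg_neg, add_sub_cancel_left] at this
  · intro h m
    ext l a b
    have := h (-m) (l - -m) a b
    rw [phiMap_inclTensor, ← this, neg_neg, add_sub_cancel]
    rfl

omit [LieConformalAlgebra L] in
-- Evaluation at `x` turns `∂` into `-x`, so `∂ ⊗ 1 + 1 ⊗ ∂` becomes `-(x + y)`, matching `∂` on a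
-- functional evaluated at `x + y`.
lemma tensorFunctional_evOn_smul (V : Submodule ℂ[X] (ConformalDual L)) (x y : ℂ) (a b : L)
    (t : ↥V ⊗[ℂ] ↥V) :
    tensorFunctional (evOn V x a) (evOn V y b)
        (LinearMap.rTensor ↥V (Algebra.lsmul ℂ ℂ ↥V (X : ℂ[X])) t +
          LinearMap.lTensor ↥V (Algebra.lsmul ℂ ℂ ↥V (X : ℂ[X])) t) =
      -(x + y) * tensorFunctional (evOn V x a) (evOn V y b) t := by
  have h : ∀ (l : ℂ) (c : L) (g : ↥V), evOn V l c ((X : ℂ[X]) • g) = -l * evOn V l c g := by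
    intro l c g
    change ev l c ((X : ℂ[X]) • g.1) = -l * ev l c g.1
    rw [ev_smul, Polynomial.eval_X]
  induction t using TensorProduct.induction_on with
  | zero => simp
  | tmul f g =>
    simp only [map_add, LinearMap.rTensor_tmul, LinearMap.lTensor_tmul, tensorFunctional_tmul,
      Algebra.lsmul_coe, h]
    ring
  | add s t hs ht =>
    simp only [map_add] at hs ht ⊢
    linear_combination hs + ht

/-- It suffices to check goodness on generators. -/
lemma isGood_span (S : Set (ConformalDual L))
    (h : ∀ f ∈ S, ∃ t : ↥(Submodule.span ℂ[X] S) ⊗[ℂ] ↥(Submodule.span ℂ[X] S),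
      ∀ (x y : ℂ) (a b : L), ev (x + y) (subst (C (-x)) (LieConformalAlgebra.bracket a b)) f =
        tensorFunctional (evOn _ x a) (evOn _ y b) t) :
    IsGood (Submodule.span ℂ[X] S) := by
  intro f hf
  simp only [piMap_eq_phiMap_iff]
  induction hf using Submodule.span_induction with
  | mem f hf => exact h f hf
  | zero => exact ⟨0, fun x y a b => by simp⟩
  | add f g _ _ hf hg =>
    obtain ⟨t, ht⟩ := hf
    obtain ⟨u, hu⟩ := hg
    exact ⟨t + u, fun x y a b => by simp only [map_add, ht, hu]⟩
  | smul p f _ hf =>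
    induction p using Polynomial.induction_on with
    | C c =>
      obtain ⟨t, ht⟩ := hf
      refine ⟨c • t, fun x y a b => ?_⟩
      rw [ev_smul, map_smul, ht, eval_C, smul_eq_mul]
    | add p q hp hq =>
      obtain ⟨t, ht⟩ := hp
      obtain ⟨u, hu⟩ := hq
      exact ⟨t + u, fun x y a b => by simp only [add_smul, map_add, ht, hu]⟩
    | monomial n c hp =>
      obtain ⟨t, ht⟩ := hp
      refine ⟨LinearMap.rTensor _ (Algebra.lsmul ℂ ℂ _ (X : ℂ[X])) t +
        LinearMap.lTensor _ (Algebra.lsmul ℂ ℂ _ (X : ℂ[X])) t, fun x y a b => ?_⟩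
      rw [tensorFunctional_evOn_smul, ← ht, ev_smul, ev_smul]
      simp only [eval_mul, eval_C, eval_pow, eval_X]
      ring

end Good

/-! ### Annihilators of subcoalgebras -/

section Annihilator

variable {L : Type*} [AddCommGroup L] [Module ℂ L] [Module ℂ[X] L] [IsScalarTower ℂ ℂ[X] L]

/-- An element of the conformal dual as a `ℂ[∂]`-linear map `L → ℂ[λ]`, with `∂` acting on
`ℂ[λ]` as multiplication by `λ`. -/
noncomputable def ConformalDual.toPolyLin (f : ConformalDual L) : L →ₗ[ℂ[X]] ℂ[X] where
  toFun := f.toLin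
  map_add' := map_add _
  map_smul' p a := toLin_apply_smul p a f

/-- The common kernel of the elements of `N`. -/
noncomputable def conformalAnnihilator (N : Submodule ℂ[X] (ConformalDual L)) :
    Submodule ℂ[X] L :=
  ⨅ f : ↥N, LinearMap.ker f.1.toPolyLin

lemma mem_conformalAnnihilator (N : Submodule ℂ[X] (ConformalDual L)) (a : L) :
    a ∈ conformalAnnihilator N ↔ ∀ f ∈ N, f.toLin a = 0 := by
  simp [conformalAnnihilator, ConformalDual.toPolyLin]

/-- A maximal independent subset `s` of `N` is finite and has the same common kernel as `N`, so the
quotient embeds in the finite free module `ℂ[∂]^s`. -/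
lemma cofiniteRank_conformalAnnihilator (N : Submodule ℂ[X] (ConformalDual L))
    (hN : Module.rank ℂ[X] N < Cardinal.aleph0) : CofiniteRank (conformalAnnihilator N) := by
  obtain ⟨s, hs, hli⟩ := exists_set_linearIndependent_of_isDomain ℂ[X] ↥N
  have hfin : s.Finite := by
    rw [← Cardinal.lt_aleph0_iff_set_finite, hs]
    exact hN
  have := hfin.to_subtype
  have htors : Module.IsTorsion ℂ[X] (↥N ⧸ Submodule.span ℂ[X] s) := by
    rw [← Module.rank_eq_zero_iff_isTorsion]
    have h1 := rank_quotient_add_rank_of_isDomain (Submodule.span ℂ[X] s)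
    rw [rank_span_set hli, hs] at h1
    exact Cardinal.eq_of_add_eq_add_right (h1.trans (zero_add _).symm) hN
  let F : L →ₗ[ℂ[X]] (s → ℂ[X]) := LinearMap.pi fun f => f.1.1.toPolyLin
  have hker : conformalAnnihilator N = LinearMap.ker F := by
    ext a
    rw [mem_conformalAnnihilator, LinearMap.mem_ker]
    constructor
    · intro h
      funext f
      exact h f.1.1 f.1.2
    · intro h f hf
      have hspan : ∀ x ∈ Submodule.span ℂ[X] s, x.1.toLin a = 0 := by
        intro x hx
        induction hx using Submodule.span_induction with
        | mem x hx => exact congrFun h ⟨x, hx⟩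
        | zero => simp
        | add x y _ _ hx hy => simp [hx, hy]
        | smul p x _ hx =>
          rw [Submodule.coe_smul, ConformalDual.toLin_smul, hx, mul_zero]
      -- Some nonzero multiple `p • f` lies in the span of `s`, so `p(-λ) f_λ(a) = 0`, and `ℂ[λ]` is
      -- a domain.
      obtain ⟨p, hp⟩ := @htors (Submodule.Quotient.mk ⟨f, hf⟩)
      have hp' : (p : ℂ[X]) • (⟨f, hf⟩ : ↥N) ∈ Submodule.span ℂ[X] s := by
        rw [← Submodule.Quotient.mk_eq_zero]
        exact hp
      have := hspan _ hp'
      rw [Submodule.coe_smul, ConformalDual.toLin_smul, mul_eq_zero, comp_neg_X_eq_zero_iff] at this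
      exact this.resolve_left (nonZeroDivisors.ne_zero p.2)
  rw [CofiniteRank, hker]
  have : Module.Finite ℂ[X] (L ⧸ LinearMap.ker F) :=
    Module.Finite.equiv F.quotKerEquivRange.symm
  exact Module.rank_lt_aleph0 _ _

variable [LieConformalAlgebra L]

/-- The annihilator of a subcoalgebra of `L⁰` is an ideal. -/
lemma isIdeal_conformalAnnihilator {N : Submodule ℂ[X] ↥(upperZero L)} (hN : IsSubcoalgebra N) :
    IsIdeal (conformalAnnihilator (N.map (upperZero L).subtype)) := by
  have hev : ∀ b ∈ conformalAnnihilator (N.map (upperZero L).subtype), ∀ (y : ℂ), ∀ f ∈ N,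
      evOn (upperZero L) y b f = 0 := by
    intro b hb y f hf
    rw [evOn_apply, ev_apply, (mem_conformalAnnihilator _ b).1 hb f.1 ⟨f, hf, rfl⟩, eval_zero]
  have key : ∀ f ∈ N, ∀ (x y : ℂ) (a b : L),
      (a ∈ conformalAnnihilator (N.map (upperZero L).subtype) ∨
        b ∈ conformalAnnihilator (N.map (upperZero L).subtype)) →
      ev (x + y) (subst (C (-x)) (LieConformalAlgebra.bracket a b)) f.1 = 0 := by
    intro f hf x y a b hab
    -- The coproduct of `f` lies in `N ⊗ N`, and one of the two evaluations vanishes on `N`.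
    refine (tensorFunctional_coproduct upperZero_isGood f x y a b).symm.trans ?_
    exact tensorFunctional_eq_zero_of_mem_range
      (hab.imp (fun h => hev a h x) fun h => hev b h y) (hN f hf)
  intro a b hb
  simp only [mem_range_lTensor_iff, mem_conformalAnnihilator]
  refine ⟨?_, ?_⟩
  · rintro z _ ⟨f, hf, rfl⟩
    refine Polynomial.funext fun l => ?_
    simpa [ev_apply] using key f hf (-z) (l + z) a b (Or.inr hb)
  · rintro z _ ⟨f, hf, rfl⟩
    refine Polynomial.funext fun l => ?_
    simpa [ev_apply] using key f hf (-z) (l + z) b a (Or.inl hb)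

end Annihilator

/-! ### The upper zero of `Cur g` and its locally finite part -/

namespace ShiftLie

lemma toLin_theta (i : ℕ) (u : Cur ShiftLie) :
    (Theta ((1 : ℂ[X]) ⊗ₜ[ℂ] eStar i)).toLin u = coord i u := by
  induction u using TensorProduct.induction_on with
  | zero => simp
  | tmul p v => rw [Theta_apply, coord_tmul, smul_eq_C_mul]; simp [mul_comm]
  | add x y hx hy => simp only [map_add, hx, hy]

lemma ev_theta (i : ℕ) (l : ℂ) (u : Cur ShiftLie) :
    ev l u (Theta ((1 : ℂ[X]) ⊗ₜ[ℂ] eStar i)) = (coord i u).eval l := by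
  rw [ev_apply, toLin_theta]

lemma eStar_succ_lie (i : ℕ) (x y : ShiftLie) : eStar (i + 1) ⁅x, y⁆ =
    eStar 0 x * eStar (i + 2) y - eStar (i + 2) x * eStar 0 y := by
  rw [lie_def, map_sub, map_smul, map_smul, eStar_shift (by omega), eStar_shift (by omega),
    smul_eq_mul, smul_eq_mul]
  ring

/-- With `λ = -x` and `∂` evaluated at `x + y`, the factors `f(-λ)` and `h(λ + ∂)` become `f(x)` and
`h(y)`. -/
lemma coord_succ_subst_bracket (i : ℕ) (x y : ℂ) (a b : Cur ShiftLie) :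
    (coord (i + 1) (subst (C (-x)) (LieConformalAlgebra.bracket a b))).eval (x + y) =
      (coord 0 a).eval x * (coord (i + 2) b).eval y -
        (coord (i + 2) a).eval x * (coord 0 b).eval y := by
  induction a using TensorProduct.induction_on with
  | zero => simp
  | add u v hu hv => simp only [map_add, LinearMap.add_apply, eval_add, hu, hv]; ring
  | tmul f u =>
    induction b using TensorProduct.induction_on with
    | zero => simp
    | add u v hu hv => simp only [map_add, eval_add, hu, hv]; ring
    | tmul h v =>
      change eval _ (coord _ (subst _ (curBracket ShiftLie _ _))) = _
      rw [subst_curBracket]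
      simp only [coord_tmul, eStar_succ_lie, eval_smul, eval_mul, eval_comp, eval_neg, eval_add,
        eval_C, eval_X, neg_neg, smul_eq_mul, neg_add_cancel_left]
      ring

lemma isGood_span_theta :
    IsGood (Submodule.span ℂ[X] (Set.range fun i => Theta ((1 : ℂ[X]) ⊗ₜ[ℂ] eStar i))) := by
  refine isGood_span _ ?_
  rintro _ ⟨i, rfl⟩
  rcases i with - | i
  -- `e_0^*` vanishes on all brackets, so its coproduct is zero.
  · refine ⟨0, fun x y a b => ?_⟩
    rw [ev_theta, coord_zero_subst_bracket, map_zero, eval_zero]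
  · have hmem : ∀ i, Theta ((1 : ℂ[X]) ⊗ₜ[ℂ] eStar i) ∈
        Submodule.span ℂ[X] (Set.range fun i => Theta ((1 : ℂ[X]) ⊗ₜ[ℂ] eStar i)) :=
      fun i => Submodule.subset_span ⟨i, rfl⟩
    refine ⟨⟨_, hmem 0⟩ ⊗ₜ ⟨_, hmem (i + 2)⟩ - ⟨_, hmem (i + 2)⟩ ⊗ₜ ⟨_, hmem 0⟩,
      fun x y a b => ?_⟩
    rw [map_sub, tensorFunctional_tmul, tensorFunctional_tmul]
    simp only [evOn_apply, ev_theta, coord_succ_subst_bracket]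

lemma map_theta_restrictedDual_le :
    (restrictedDual.baseChange ℂ[X]).map Theta ≤ upperZero (Cur ShiftLie) := by
  refine le_trans ?_ (le_sSup isGood_span_theta)
  rw [restrictedDual, Submodule.baseChange_span, Submodule.map_span, Submodule.span_le]
  rintro _ ⟨_, ⟨_, ⟨i, rfl⟩, rfl⟩, rfl⟩
  exact Submodule.subset_span ⟨i, rfl⟩

lemma theta_mem_upperZero (i : ℕ) :
    Theta ((1 : ℂ[X]) ⊗ₜ[ℂ] eStar i) ∈ upperZero (Cur ShiftLie) :=
  (le_sSup isGood_span_theta : _ ≤ upperZero (Cur ShiftLie)) (Submodule.subset_span ⟨i, rfl⟩)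

lemma theta_eStar_zero_ne_zero : Theta ((1 : ℂ[X]) ⊗ₜ[ℂ] eStar 0) ≠ 0 := by
  intro h
  have h1 := toLin_theta 0 ((1 : ℂ[X]) ⊗ₜ[ℂ] e 0)
  rw [h] at h1
  simp [eStar_e] at h1

/-- Every multiple of `Θ(1 ⊗ e_0^*)` vanishes at `1 ⊗ e_1`, where `Θ(1 ⊗ e_1^*)` takes the value
`1`. -/
lemma theta_eStar_one_notMem :
    Theta ((1 : ℂ[X]) ⊗ₜ[ℂ] eStar 1) ∉
      Submodule.span ℂ[X] {Theta ((1 : ℂ[X]) ⊗ₜ[ℂ] eStar 0)} := by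
  intro h
  obtain ⟨p, hp⟩ := Submodule.mem_span_singleton.1 h
  have h1 := toLin_theta 1 ((1 : ℂ[X]) ⊗ₜ[ℂ] e 1)
  rw [← hp, ConformalDual.toLin_smul, toLin_theta] at h1
  simp [eStar_e] at h1

/-- The annihilator of `N` contains all `e_i` with `i ≥ 1`, so an element of `N` is determined by
its value at `1 ⊗ e_0`. -/
lemma subcoalgebra_le_span {N : Submodule ℂ[X] ↥(upperZero (Cur ShiftLie))}
    (hN : IsSubcoalgebra N) (hr : Module.rank ℂ[X] N < Cardinal.aleph0) :
    N.map (upperZero (Cur ShiftLie)).subtype ≤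
      Submodule.span ℂ[X] {Theta ((1 : ℂ[X]) ⊗ₜ[ℂ] eStar 0)} := by
  have hr' : Module.rank ℂ[X] (N.map (upperZero (Cur ShiftLie)).subtype) < Cardinal.aleph0 :=
    (rank_map_le _ _).trans_lt hr
  have he := tmul_e_succ_mem_of_cofiniteRank (isIdeal_conformalAnnihilator hN)
    (cofiniteRank_conformalAnnihilator _ hr')
  intro f hf
  rw [Submodule.mem_span_singleton]
  -- The substitution `λ ↦ -λ` cancels the sign in the action `(p f)_λ = p(-λ) f_λ`.
  refine ⟨(f.toLin ((1 : ℂ[X]) ⊗ₜ[ℂ] e 0)).comp (-X), ?_⟩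
  apply ConformalDual.toLin_injective
  refine LinearMap.ext fun u => ?_
  have h := (mem_conformalAnnihilator _ _).1 (sub_coord_smul_mem he u) f hf
  rw [map_sub, sub_eq_zero, toLin_apply_smul] at h
  rw [ConformalDual.toLin_smul, toLin_theta, h, comp_neg_X_comp_neg_X, mul_comm]

lemma span_theta_eq_map_Loc :
    Submodule.span ℂ[X] {Theta ((1 : ℂ[X]) ⊗ₜ[ℂ] eStar 0)} =
      (Loc ↥(upperZero (Cur ShiftLie))).map (upperZero (Cur ShiftLie)).subtype := by
  apply le_antisymm
  · set x : ↥(upperZero (Cur ShiftLie)) := ⟨_, theta_mem_upperZero 0⟩ with hx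
    have hle : Submodule.span ℂ[X] {x} ≤ Loc ↥(upperZero (Cur ShiftLie)) := by
      refine le_sSup ⟨fun f hf => ?_, (rank_span_le _).trans_lt (by simp)⟩
      obtain ⟨p, rfl⟩ := Submodule.mem_span_singleton.1 hf
      -- The span has zero coproduct because its elements all kill brackets.
      refine ⟨0, ?_⟩
      rw [map_zero, eq_comm]
      refine tensor_ext_evOn _ _ fun y z a b => ?_
      refine (tensorFunctional_coproduct upperZero_isGood _ y z a b).trans ?_
      rw [evOn_apply, Submodule.coe_smul, ev_smul, hx, ev_theta, coord_zero_subst_bracket]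
      simp
    have := Submodule.map_mono (f := (upperZero (Cur ShiftLie)).subtype) hle
    rwa [Submodule.map_span, Set.image_singleton] at this
  · rw [Loc, (Submodule.gc_map_comap _).l_sSup]
    exact iSup₂_le fun N hN => subcoalgebra_le_span hN.1 hN.2

/-! ### The coproduct on the restricted dual -/

lemma inclDual_tmul_tmul {g : Type*} [LieRing g] [LieAlgebra ℂ g]
    {V : Submodule ℂ (Module.Dual ℂ g)} (φ ψ : ↥V) (x y : g) :
    inclDual V (φ ⊗ₜ ψ) (x ⊗ₜ y) = φ.1 x * ψ.1 y := by
  simp [inclDual]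

lemma bracketTranspose_eStar_zero : bracketTranspose ShiftLie (eStar 0) = 0 := by
  refine TensorProduct.ext' fun x y => ?_
  rw [bracketTranspose_apply, eStar_zero_lie, LinearMap.zero_apply]

lemma bracketTranspose_eStar_succ (i : ℕ) : bracketTranspose ShiftLie (eStar (i + 1)) =
    inclDual restrictedDual
      (eStarR 0 ⊗ₜ[ℂ] eStarR (i + 2) - eStarR (i + 2) ⊗ₜ[ℂ] eStarR 0) := by
  refine TensorProduct.ext' fun x y => ?_
  rw [bracketTranspose_apply, eStar_succ_lie, map_sub, LinearMap.sub_apply, inclDual_tmul_tmul,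
    inclDual_tmul_tmul]
  rfl

lemma isGoodSubspace_restrictedDual : IsGoodSubspace restrictedDual := by
  change restrictedDual ≤ (LinearMap.range (inclDual restrictedDual)).comap
    (bracketTranspose ShiftLie)
  refine Submodule.span_le.2 ?_
  rintro _ ⟨i, rfl⟩
  rcases i with - | i
  · exact ⟨0, by rw [map_zero, bracketTranspose_eStar_zero]⟩
  · exact ⟨_, (bracketTranspose_eStar_succ i).symm⟩

end ShiftLie

end ConformalAlg

theorem mainTheorem5 :
    -- (a) each `J_a` is an ideal, and the nontrivial ideals of cofinite rank are exactly the
    -- `J_a` with `a` not a nonzero constant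
    ((∀ a : ℂ[X], IsIdeal (J a)) ∧
      ∀ I : Submodule ℂ[X] (Cur ShiftLie),
        (IsIdeal I ∧ CofiniteRank I ∧ I ≠ ⊥ ∧ I ≠ ⊤) ↔ ∃ a : ℂ[X], ¬ IsUnit a ∧ I = J a) ∧
    -- (b) `0 ≠ ℂ[∂]e_0^* = Loc((Cur g)⁰)`, inside the conformal dual of `Cur g`
    (Submodule.span ℂ[X] {Theta ((1 : ℂ[X]) ⊗ₜ[ℂ] eStar 0)} ≠ ⊥ ∧
      Submodule.span ℂ[X] {Theta ((1 : ℂ[X]) ⊗ₜ[ℂ] eStar 0)} =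
        (Loc ↥(upperZero (Cur ShiftLie))).map (upperZero (Cur ShiftLie)).subtype) ∧
    -- (c) `⊕ ℂ e_i^*` is a good subspace of `g^*`, with the stated coproduct
    (∃ h : IsGoodSubspace restrictedDual,
      goodCoproduct h (eStarR 0) = 0 ∧
        ∀ i : ℕ, 1 ≤ i → goodCoproduct h (eStarR i) =
          eStarR 0 ⊗ₜ[ℂ] eStarR (i + 1) - eStarR (i + 1) ⊗ₜ[ℂ] eStarR 0) ∧
    -- (d) `Θ(Cur(⊕ ℂ e_i^*)) ⊆ (Cur g)⁰`
    (restrictedDual.baseChange ℂ[X]).map Theta ≤ upperZero (Cur ShiftLie) ∧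
    -- (e) `0 ≠ Loc((Cur g)⁰) ⊊ (Cur g)⁰`
    (Loc ↥(upperZero (Cur ShiftLie)) ≠ ⊥ ∧ Loc ↥(upperZero (Cur ShiftLie)) < ⊤) := by
  have hne : Submodule.span ℂ[X] {Theta ((1 : ℂ[X]) ⊗ₜ[ℂ] eStar 0)} ≠ ⊥ := by
    rw [Ne, Submodule.span_singleton_eq_bot]
    exact theta_eStar_zero_ne_zero
  refine ⟨⟨isIdeal_J, isIdeal_cofiniteRank_iff⟩, ⟨hne, span_theta_eq_map_Loc⟩,
    ⟨isGoodSubspace_restrictedDual, ?_, ?_⟩, map_theta_restrictedDual_le, ?_, ?_⟩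
  · apply inclDual_injective
    rw [inclDual_goodCoproduct, map_zero]
    exact bracketTranspose_eStar_zero
  · rintro i hi
    obtain ⟨i, rfl⟩ := Nat.exists_eq_add_of_le' hi
    apply inclDual_injective
    rw [inclDual_goodCoproduct]
    exact bracketTranspose_eStar_succ i
  -- Both claims of (e) are read off from the description of `Loc` in (b).
  · intro h
    rw [span_theta_eq_map_Loc, h, Submodule.map_bot] at hne
    exact hne rfl
  · rw [lt_top_iff_ne_top]
    intro h
    refine theta_eStar_one_notMem ?_
    rw [span_theta_eq_map_Loc, h, Submodule.map_top, Submodule.range_subtype]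
    exact theta_mem_upperZero 1
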